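/- For a partition of $N$, the hook length of a cell of its Young diagram is the number of cells directly to its right, plus the number of cells directly below it, plus one. A partition is a $t$-core if it has no hook of length $t$ (equivalently, no hook length divisible by $t$). Let $c_t(N)$ be the number of $t$-core partitions of $N$, and put $$M = N + \frac{t^2-1}{24}, \qquad y = \frac{t-1}{4\pi M}.$$ There is an absolute constant $C > 0$ such that, for every real $\varepsilon > 0$ and all integers $t \ge 6$ and $N \ge 0$ with $$\frac{t(t-1)}{4\pi M} \le \frac{2\pi}{(2+\varepsilon)\log t},$$ we have $$c_t(N) = \frac{(2\pi)^{\frac{t-1}{2}}}{t^{\frac t2}\,\Gamma\!\left(\frac{t-1}{2}\right)}\, M^{\frac{t-3}{2}}\,(1+\delta)$$ for some real $\delta$ (depending on $t$ and $N$) with $$|\delta| \le C\left(t^{-\frac12}(1+\varepsilon)^{-\frac t4} + e^{-\frac t6} + t\,e^{-\frac{2\pi}{ty}}\right).$$ In particular the implied constant does not depend on $\varepsilon$, $t$ or $N$. -/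

import Mathlib

/-- The hook length of the cell `c = (i, j)` of a Young diagram `μ` (rows and columns indexed
from `0`): the arm `rowLen i - (j + 1)`, plus the leg `colLen j - (i + 1)`, plus one. For a cell of
`μ` neither subtraction truncates. -/
def hookLength (μ : YoungDiagram) (c : ℕ × ℕ) : ℕ :=
  (μ.rowLen c.1 - (c.2 + 1)) + (μ.colLen c.2 - (c.1 + 1)) + 1

/-- A partition, given by its Young diagram, is a `t`-core if it has no hook of length `t`. -/
def IsTCore (t : ℕ) (μ : YoungDiagram) : Prop :=
  ∀ c ∈ μ, hookLength μ c ≠ t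

/-- The set of `t`-core partitions of `N`. -/
def tCores (t N : ℕ) : Set YoungDiagram :=
  {μ | μ.card = N ∧ IsTCore t μ}

/-- There are only finitely many `t`-core partitions of `N`, so that the cardinality `tCoreCount`
below is the honest one. -/
theorem tCores_finite (t N : ℕ) : (tCores t N).Finite := by
  have key : ∀ μ : YoungDiagram, μ.card = N →
      μ.cells ∈ (Finset.range N ×ˢ Finset.range N).powerset := by
    intro μ hμ
    rw [Finset.mem_powerset]
    rintro ⟨i, j⟩ hc
    have hc' : (i, j) ∈ μ := hc
    have h1 : j < μ.rowLen i := YoungDiagram.mem_iff_lt_rowLen.1 hc'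
    have h2 : i < μ.colLen j := YoungDiagram.mem_iff_lt_colLen.1 hc'
    have h3 : μ.rowLen i ≤ N := by
      rw [YoungDiagram.rowLen_eq_card, ← hμ]
      exact Finset.card_le_card (Finset.filter_subset _ _)
    have h4 : μ.colLen j ≤ N := by
      rw [YoungDiagram.colLen_eq_card, ← hμ]
      exact Finset.card_le_card (Finset.filter_subset _ _)
    simp only [Finset.mem_product, Finset.mem_range]
    omega
  refine Set.Finite.of_finite_image (f := YoungDiagram.cells)
    ((Finset.finite_toSet (Finset.range N ×ˢ Finset.range N).powerset).subset ?_) ?_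
  · rintro _ ⟨μ, hμ, rfl⟩
    exact key μ hμ.1
  · intro μ _ ν _ h
    exact YoungDiagram.ext h

/-- `c_t(N)`, the number of `t`-core partitions of `N`. -/
noncomputable def tCoreCount (t N : ℕ) : ℕ := (tCores t N).ncard

/-- `M = N + (t ^ 2 - 1) / 24`. -/
noncomputable def shiftedSize (t N : ℕ) : ℝ := (N : ℝ) + ((t : ℝ) ^ 2 - 1) / 24

/-- `y = (t - 1) / (4 π M)`. -/
noncomputable def saddleY (t N : ℕ) : ℝ := ((t : ℝ) - 1) / (4 * Real.pi * shiftedSize t N)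

/-- The main term `(2π)^((t-1)/2) / (t^(t/2) Γ((t-1)/2)) * M^((t-3)/2)`. -/
noncomputable def tCoreMainTerm (t N : ℕ) : ℝ :=
  (2 * Real.pi) ^ (((t : ℝ) - 1) / 2)
    / ((t : ℝ) ^ ((t : ℝ) / 2) * Real.Gamma (((t : ℝ) - 1) / 2))
    * shiftedSize t N ^ (((t : ℝ) - 3) / 2)

/-!
The proof is the circle method, applied to the generating function of `t`-cores, which is an eta
quotient.

*Generating function.* Encode a partition by the set of its beads `μ_i + (k - 1 - i)`, `i < k`. A
hook length is the difference between a bead and an unoccupied position below it, so `t`-cores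
are the configurations in which all beads are pushed up on the `t` runners of an abacus
(`isTCore_iff_beadSet`). They are parametrised by integer vectors of length `t` with sum zero, and
their size is a quadratic polynomial `coreSize` of the vector. Splitting
`∏ (1 + w q ^ i)`, `i < t * L`, into residue classes modulo `t` and comparing coefficients by the
`q`-binomial theorem gives an identity between Gaussian binomial coefficients
(`gaussBinom_mul_eq_sum`), whose limit is
`∑ c_t(N) q ^ N = ∏ (1 - q ^ (t n)) ^ t / (1 - q ^ n)` (`hasSum_tCoreCount`). Hence `c_t(N)` is the
integral of `F(z) e ^ (-2 π i M z)` over a segment of length one on the line `im z = y`, where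
`F(z) = η(t z) ^ t / η(z)` (`tCoreCount_eq_integral`); the height `y` is the saddle point.

*Major arc, `|x| ≤ y`.* The transformation `z ↦ -1 / z` turns `F(z)` into
`t ^ (-t / 2) (-i z) ^ (-(t - 1) / 2)` times a factor `1 + O(t e ^ (-2 π / (t y)))` near `x = 0`
(`coreQuot_eq_cuspFactor`, `norm_cuspFactor_sub_one_le`). The power of `-i z`, integrated over the
whole line, is the inverse Fourier transform of a Gamma density and equals the main term exactly
(`tCoreMainTerm_eq_integral`); its tail `|x| > y` is small since `|z| ^ 2 ≥ 2 y ^ 2` there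
(`exists_tail_le`).

*Minor arcs, `y ≤ x ≤ 1 - y`.* The function `(im z) ^ (1 / 4) |η(z)|` is invariant under `SL(2, ℤ)`
and bounded. If `z` is equivalent to a point of the fundamental domain of height `Y`, then `t z` is
equivalent to a point of height at least `Y / t`. For `Y ≥ t` the exponential growth of `1 / η(z)`
is therefore cancelled by the decay of `η(t z) ^ t`, and `F` is bounded by a power of `Y y`
relative to its peak (`exists_norm_coreQuot_le`). On the minor arcs `Y y ≤ 1 / 2`, which saves
`2 ^ (-t / 4)`, up to a factor `e ^ (t / 200)` from the product for `η`. This suffices because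
`log 2 / 4 > 1 / 6 + 1 / 200`. The peak has width at most `y`, so a power of `y` would be lost by
integrating a constant; instead a fixed power of `Y y` is kept and integrated, by comparison with a
truncated Eisenstein series (`height_mul_le`, `exists_integral_heightSum_le`). For `Y < t`
everything is at most `D ^ t (t y) ^ (t / 4)`, up to powers of `t` and `y`, which is negligible
since `t y ≤ π / log t` (`exists_pow_mul_rpow_le`).

Finally the main term is compared with the size of the integrand at the saddle point by Stirling's
formula (`exists_le_tCoreMainTerm`).
-/

section Combinatorics

open Finset Filter Topology

/-! ### Bead sets of partitions -/

/-- The Young diagram with row lengths `r 0 ≥ r 1 ≥ …`, where `r` vanishes from `k` on. -/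
def YoungDiagram.ofAntitone (r : ℕ → ℕ) (hr : Antitone r) (k : ℕ) : YoungDiagram where
  cells := (range k ×ˢ range (r 0)).filter fun c => c.2 < r c.1
  isLowerSet := by
    rintro ⟨i, j⟩ ⟨i', j'⟩ h hc
    have h1 : i' ≤ i := h.1
    have h2 : j' ≤ j := h.2
    have h3 := hr h1
    have h4 := hr (Nat.zero_le i')
    simp only [coe_filter, mem_product, mem_range, Set.mem_ofPred_eq] at hc ⊢
    omega

theorem YoungDiagram.rowLen_ofAntitone {r : ℕ → ℕ} (hr : Antitone r) {k : ℕ}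
    (hk : ∀ i, k ≤ i → r i = 0) (i : ℕ) : (YoungDiagram.ofAntitone r hr k).rowLen i = r i := by
  refine eq_of_forall_lt_iff fun j => ?_
  rw [← YoungDiagram.mem_iff_lt_rowLen, ← YoungDiagram.mem_cells]
  simp only [YoungDiagram.ofAntitone, mem_filter, mem_product, mem_range]
  have h4 := hr (Nat.zero_le i)
  have h5 := hk i
  omega

theorem YoungDiagram.ext_rowLen {μ ν : YoungDiagram} (h : ∀ i, μ.rowLen i = ν.rowLen i) :
    μ = ν := by
  ext ⟨i, j⟩
  rw [YoungDiagram.mem_cells, YoungDiagram.mem_cells, YoungDiagram.mem_iff_lt_rowLen,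
    YoungDiagram.mem_iff_lt_rowLen, h]

theorem YoungDiagram.card_eq_sum_rowLen {μ : YoungDiagram} {k : ℕ}
    (hk : ∀ i, k ≤ i → μ.rowLen i = 0) : μ.card = ∑ i ∈ range k, μ.rowLen i := by
  rw [YoungDiagram.card, card_eq_sum_card_fiberwise (f := Prod.fst) (t := range k)]
  · refine sum_congr rfl fun i _ => ?_
    rw [YoungDiagram.rowLen_eq_card]
    rfl
  · rintro ⟨i, j⟩ h
    have h' : j < μ.rowLen i := YoungDiagram.mem_iff_lt_rowLen.1 h
    simp only [coe_range, Set.mem_Iio]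
    by_contra h2
    rw [hk i (by omega)] at h'
    omega

theorem YoungDiagram.rowLen_eq_zero_of_card_le {μ : YoungDiagram} {i : ℕ} (h : μ.card ≤ i) :
    μ.rowLen i = 0 := by
  by_contra h0
  have hsub : (range (i + 1)).image (fun a => (a, 0)) ⊆ μ.cells := by
    intro c hc
    obtain ⟨a, ha, rfl⟩ := mem_image.1 hc
    have h1 : (i, 0) ∈ μ := YoungDiagram.mem_iff_lt_rowLen.2 (Nat.pos_of_ne_zero h0)
    exact μ.up_left_mem (by have := mem_range.1 ha; omega) le_rfl h1
  have := card_le_card hsub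
  rw [card_image_of_injective _ (fun a b h => (Prod.mk.inj h).1), card_range] at this
  have h2 : μ.cells.card = μ.card := rfl
  omega

/-- The beads of `μ` on a one-runner abacus with `k` beads: the numbers `μ_i + (k - 1 - i)`,
`i < k`. -/
def beadSet (k : ℕ) (μ : YoungDiagram) : Finset ℕ :=
  (range k).image fun i => μ.rowLen i + (k - 1 - i)

theorem bead_injOn (k : ℕ) (μ : YoungDiagram) :
    Set.InjOn (fun i => μ.rowLen i + (k - 1 - i)) (range k) := by
  intro i hi j hj h
  simp only [coe_range, Set.mem_Iio] at hi hj h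
  rcases lt_trichotomy i j with hij | hij | hij
  · have := μ.rowLen_anti i j hij.le
    omega
  · exact hij
  · have := μ.rowLen_anti j i hij.le
    omega

theorem card_beadSet (k : ℕ) (μ : YoungDiagram) : (beadSet k μ).card = k := by
  rw [beadSet, card_image_of_injOn (bead_injOn k μ), card_range]

theorem sum_beadSet {k : ℕ} {μ : YoungDiagram} (hk : ∀ i, k ≤ i → μ.rowLen i = 0) :
    ∑ x ∈ beadSet k μ, x = μ.card + k.choose 2 := by
  rw [beadSet, sum_image (bead_injOn k μ), sum_add_distrib, YoungDiagram.card_eq_sum_rowLen hk,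
    sum_range_reflect (fun i => i) k, sum_range_id, Nat.choose_two_right]

theorem mem_beadSet {k : ℕ} {μ : YoungDiagram} {x : ℕ} :
    x ∈ beadSet k μ ↔ ∃ i < k, μ.rowLen i + (k - 1 - i) = x := by
  simp [beadSet]

theorem beadSet_injOn (k : ℕ) :
    Set.InjOn (beadSet k) {μ | ∀ i, k ≤ i → μ.rowLen i = 0} := by
  -- the `i`-th bead in decreasing order has exactly `i` beads above it
  have key : ∀ (μ : YoungDiagram) (i : ℕ), i < k →
      ((beadSet k μ).filter fun x => μ.rowLen i + (k - 1 - i) < x).card = i := by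
    intro μ i hi
    have : (beadSet k μ).filter (fun x => μ.rowLen i + (k - 1 - i) < x)
        = (range i).image fun i => μ.rowLen i + (k - 1 - i) := by
      ext x
      simp only [mem_filter, mem_beadSet, mem_image, mem_range]
      constructor
      · rintro ⟨⟨j, hj, rfl⟩, h⟩
        refine ⟨j, ?_, rfl⟩
        by_contra hij
        have := μ.rowLen_anti i j (by omega)
        omega
      · rintro ⟨j, hj, rfl⟩
        have := μ.rowLen_anti j i hj.le
        exact ⟨⟨j, by omega, rfl⟩, by omega⟩
    rw [this, card_image_of_injOn, card_range]
    exact (bead_injOn k μ).mono (by simpa using hi.le)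
  intro μ hμ ν hν h
  refine YoungDiagram.ext_rowLen fun i => ?_
  rcases le_or_gt k i with hi | hi
  · rw [hμ i hi, hν i hi]
  have hm : μ.rowLen i + (k - 1 - i) ∈ beadSet k ν := h ▸ mem_beadSet.2 ⟨i, hi, rfl⟩
  obtain ⟨j, hj, hji⟩ := mem_beadSet.1 hm
  have h1 := key μ i hi
  have h2 := key ν j hj
  rw [hji, ← h, h1] at h2
  subst h2
  omega

theorem beadSet_surj {k : ℕ} {X : Finset ℕ} (hX : X.card = k) :
    ∃ μ : YoungDiagram, (∀ i, k ≤ i → μ.rowLen i = 0) ∧ beadSet k μ = X := by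
  set e := X.orderEmbOfFin hX with he
  have hstep : ∀ i j : Fin k, i ≤ j → (e i : ℕ) + (j - i : ℕ) ≤ e j := by
    intro i j hij
    obtain ⟨d, hd⟩ : ∃ d : ℕ, (j : ℕ) = i + d := ⟨j - i, by have := Fin.le_def.1 hij; omega⟩
    induction d generalizing j with
    | zero =>
      have : i = j := Fin.ext (by omega)
      subst this; simp
    | succ d ih =>
      have hj := j.2
      have h1 := ih ⟨i + d, by omega⟩ (Fin.le_def.2 (by simp)) rfl
      have h2 : e ⟨i + d, by omega⟩ < e j := e.lt_iff_lt.2 (Fin.lt_def.2 (by simp; omega))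
      simp only at h1
      omega
  have hle : ∀ j : Fin k, (j : ℕ) ≤ e j := by
    intro j
    have := hstep ⟨0, by have := j.2; omega⟩ j (Fin.le_def.2 (by simp))
    simp only at this
    omega
  let r : ℕ → ℕ := fun i => if h : i < k then e ⟨k - 1 - i, by omega⟩ - (k - 1 - i) else 0
  have hr : Antitone r := by
    intro i j hij
    by_cases hj : j < k
    · have hi : i < k := by omega
      simp only [r, hi, hj, dif_pos]
      have := hstep ⟨k - 1 - j, by omega⟩ ⟨k - 1 - i, by omega⟩ (Fin.le_def.2 (by simp; omega))
      have h2 := hle ⟨k - 1 - j, by omega⟩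
      simp only at this h2
      omega
    · simp [r, hj]
  have hrk : ∀ i, k ≤ i → r i = 0 := fun i hi => by simp [r, hi]
  refine ⟨YoungDiagram.ofAntitone r hr k, fun i hi => ?_, ?_⟩
  · rw [YoungDiagram.rowLen_ofAntitone hr hrk, hrk i hi]
  · refine eq_of_subset_of_card_le ?_ (by rw [card_beadSet, hX])
    intro x hx
    obtain ⟨i, hi, rfl⟩ := mem_beadSet.1 hx
    rw [YoungDiagram.rowLen_ofAntitone hr hrk]
    have h2 := hle ⟨k - 1 - i, by omega⟩
    have : r i + (k - 1 - i) = e ⟨k - 1 - i, by omega⟩ := by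
      simp only [r, hi, dif_pos]
      simp only at h2
      omega
    rw [this]
    exact X.orderEmbOfFin_mem hX _

/-- A partition is a `t`-core exactly when no bead `x` can be moved to `x - t`: the hook lengths in
row `i` are the differences between the `i`-th bead and the unoccupied positions below it. -/
theorem isTCore_iff_beadSet {t k : ℕ} (ht : 0 < t) {μ : YoungDiagram}
    (hk : ∀ i, k ≤ i → μ.rowLen i = 0) :
    IsTCore t μ ↔ ∀ x ∈ beadSet k μ, t ≤ x → x - t ∈ beadSet k μ := by
  have hcol : ∀ i j, i < μ.colLen j ↔ j < μ.rowLen i := fun i j => by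
    rw [← YoungDiagram.mem_iff_lt_rowLen, YoungDiagram.mem_iff_lt_colLen]
  have hcolk : ∀ j, μ.colLen j ≤ k := by
    intro j
    by_contra h
    have := (hcol k j).1 (by omega)
    rw [hk k le_rfl] at this
    omega
  constructor
  · intro hcore x hx htx
    obtain ⟨i, hi, rfl⟩ := mem_beadSet.1 hx
    by_contra hy
    set y := μ.rowLen i + (k - 1 - i) - t with hydef
    -- `i'` counts the beads above the unoccupied position `y`
    have hex : ∃ i', k ≤ i' ∨ μ.rowLen i' + (k - 1 - i') < y := ⟨k, Or.inl le_rfl⟩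
    classical
    set i' := Nat.find hex with hi'
    have hspec := Nat.find_spec hex
    rw [← hi'] at hspec
    have hmin : ∀ a < i', a < k ∧ y < μ.rowLen a + (k - 1 - a) := by
      intro a ha
      have := Nat.find_min hex ha
      push Not at this
      refine ⟨this.1, lt_of_le_of_ne this.2 fun h => hy ?_⟩
      exact mem_beadSet.2 ⟨a, this.1, h.symm⟩
    have hi'k : i' ≤ k := Nat.find_min' hex (Or.inl le_rfl)
    have hii' : i < i' := by
      by_contra h
      rcases hspec with h1 | h1
      · omega
      · have := μ.rowLen_anti i' i (by omega)
        omega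
    have hy1 : k ≤ y + i' := by
      rcases hspec with h1 | h1 <;> omega
    have hcl : μ.colLen (y + i' - k) = i' := by
      refine eq_of_forall_lt_iff fun a => ?_
      rw [hcol]
      constructor
      · intro h
        by_contra ha
        rcases hspec with h1 | h1
        · rw [hk a (by omega)] at h
          omega
        · have := μ.rowLen_anti i' a (by omega)
          omega
      · intro h
        have h1 := hmin (i' - 1) (by omega)
        have h2 := μ.rowLen_anti a (i' - 1) (by omega)
        omega
    have hrow : y + i' - k < μ.rowLen i := (hcol _ _).1 (by rw [hcl]; exact hii')
    refine hcore (i, y + i' - k) (YoungDiagram.mem_iff_lt_rowLen.2 hrow) ?_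
    simp only [hookLength, hcl]
    omega
  · rintro hX ⟨i, j⟩ hc hook
    have hc1 : j < μ.rowLen i := YoungDiagram.mem_iff_lt_rowLen.1 hc
    have hc2 := (hcol i j).2 hc1
    have hc3 := hcolk j
    simp only [hookLength] at hook
    have := hX (μ.rowLen i + (k - 1 - i)) (mem_beadSet.2 ⟨i, by omega, rfl⟩) (by omega)
    obtain ⟨a, ha, hax⟩ := mem_beadSet.1 this
    have h3 := hcol a j
    omega

/-! ### Cores as bead configurations on an abacus -/

/-- The abacus with `a j` beads pushed to the top of runner `j`: the set of all `j + t * i` with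
`i < a j`. -/
def abacus {t : ℕ} (a : Fin t → ℕ) : Finset ℕ :=
  (univ.sigma fun j => range (a j)).image fun p => (p.1 : ℕ) + t * p.2

theorem abacus_position_injective {t : ℕ} :
    Function.Injective fun p : (_ : Fin t) × ℕ => (p.1 : ℕ) + t * p.2 := by
  rintro ⟨j, i⟩ ⟨j', i'⟩ h
  simp only at h
  have h1 : (j : ℕ) = j' := by
    have := congrArg (· % t) h
    simpa [Nat.add_mul_mod_self_left, Nat.mod_eq_of_lt j.2, Nat.mod_eq_of_lt j'.2] using this
  have h2 : i = i' := by
    rw [h1] at h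
    exact Nat.eq_of_mul_eq_mul_left (by have := j.2; omega : 0 < t) (by omega)
  rw [Fin.ext h1, h2]

theorem mem_abacus {t : ℕ} {a : Fin t → ℕ} (j : Fin t) (i : ℕ) :
    (j : ℕ) + t * i ∈ abacus a ↔ i < a j := by
  have := (abacus_position_injective (t := t)).mem_finset_image
      (s := univ.sigma fun j => range (a j))
    (a := ⟨j, i⟩)
  rw [abacus, this]
  simp

theorem card_abacus {t : ℕ} (a : Fin t → ℕ) : (abacus a).card = ∑ j, a j := by
  rw [abacus, card_image_of_injective _ abacus_position_injective, card_sigma]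
  simp

/-- The sum of the positions of the beads of `abacus a`. -/
def abacusWeight {t : ℕ} (a : Fin t → ℕ) : ℕ := ∑ j : Fin t, ((j : ℕ) * a j + t * (a j).choose 2)

theorem sum_abacus {t : ℕ} (a : Fin t → ℕ) : ∑ x ∈ abacus a, x = abacusWeight a := by
  rw [abacus, sum_image (abacus_position_injective.injOn), sum_sigma, abacusWeight]
  refine sum_congr rfl fun j _ => ?_
  rw [sum_add_distrib, ← mul_sum, sum_range_id, Nat.choose_two_right]
  simp [mul_comm]

theorem abacus_closed {t : ℕ} (a : Fin t → ℕ) : ∀ x ∈ abacus a, t ≤ x → x - t ∈ abacus a := by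
  intro x hx htx
  rw [abacus, mem_image] at hx
  obtain ⟨⟨j, i⟩, h, rfl⟩ := hx
  simp only [mem_sigma, mem_univ, mem_range, true_and] at h htx ⊢
  obtain _ | i := i
  · have := j.2
    omega
  · rw [show (j : ℕ) + t * (i + 1) - t = j + t * i by rw [mul_add]; omega, mem_abacus]
    omega

theorem abacus_injective {t : ℕ} : Function.Injective (abacus (t := t)) := by
  intro a b h
  funext j
  refine eq_of_forall_lt_iff fun i => ?_
  rw [← mem_abacus, ← mem_abacus, h]

theorem exists_abacus_eq {t : ℕ} (ht : 0 < t) {X : Finset ℕ}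
    (hX : ∀ x ∈ X, t ≤ x → x - t ∈ X) : ∃ a : Fin t → ℕ, abacus a = X := by
  have hex : ∀ j : Fin t, ∃ i, (j : ℕ) + t * i ∉ X := by
    intro j
    obtain ⟨B, hB⟩ := X.bddAbove
    refine ⟨B + 1, fun h => ?_⟩
    have h1 := hB h
    have : B + 1 ≤ t * (B + 1) := Nat.le_mul_of_pos_left _ ht
    omega
  classical
  refine ⟨fun j => Nat.find (hex j), ?_⟩
  have hdown : ∀ (j : Fin t) (i d : ℕ), (j : ℕ) + t * (i + d) ∈ X → (j : ℕ) + t * i ∈ X := by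
    intro j i d
    induction d with
    | zero => exact id
    | succ d ih =>
      intro h
      refine ih ?_
      have := hX _ h (by rw [← add_assoc, mul_add]; omega)
      rwa [show (j : ℕ) + t * (i + (d + 1)) - t = j + t * (i + d) by
        rw [← add_assoc, mul_add t (i + d)]; omega] at this
  ext x
  rw [show x = ((⟨x % t, Nat.mod_lt _ ht⟩ : Fin t) : ℕ)
      + t * (x / t) from (Nat.mod_add_div x t).symm,
    mem_abacus]
  set j : Fin t := ⟨x % t, Nat.mod_lt _ ht⟩
  constructor
  · intro h
    simpa using Nat.find_min (hex j) h
  · intro h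
    by_contra h2
    obtain ⟨d, hd⟩ : ∃ d, x / t = Nat.find (hex j) + d := ⟨_, (Nat.add_sub_cancel' (by omega)).symm⟩
    rw [hd] at h
    exact Nat.find_spec (hex j) (hdown j _ d h)

/-- With `k ≥ N` beads, the `t`-cores of `N` are the pushed-up abaci on `t` runners. -/
theorem tCoreCount_eq_card_abacus {t N k : ℕ} (ht : 0 < t) (hk : N ≤ k) :
    tCoreCount t N = {a : Fin t → ℕ | ∑ j, a j = k ∧ abacusWeight a = N + k.choose 2}.ncard := by
  have hzero : ∀ μ ∈ tCores t N, ∀ i, k ≤ i → μ.rowLen i = 0 := fun μ hμ i hi =>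
    YoungDiagram.rowLen_eq_zero_of_card_le (by rw [hμ.1]; omega)
  rw [tCoreCount, ← ((beadSet_injOn k).mono hzero).ncard_image,
    ← Set.ncard_image_of_injective _ (abacus_injective (t := t))]
  congr 1
  ext X
  constructor
  · rintro ⟨μ, hμ, rfl⟩
    obtain ⟨a, ha⟩ := exists_abacus_eq ht ((isTCore_iff_beadSet ht (hzero μ hμ)).1 hμ.2)
    refine ⟨a, ⟨?_, ?_⟩, ha⟩
    · rw [← card_abacus, ha, card_beadSet]
    · rw [← sum_abacus, ha, sum_beadSet (hzero μ hμ), hμ.1]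
  · rintro ⟨a, ⟨h1, h2⟩, rfl⟩
    obtain ⟨μ, hμ0, hμ⟩ := beadSet_surj ((card_abacus a).trans h1)
    refine ⟨μ, ⟨?_, ?_⟩, hμ⟩
    · have := sum_beadSet hμ0
      rw [hμ, sum_abacus, h2] at this
      omega
    · rw [isTCore_iff_beadSet ht hμ0, hμ]
      exact abacus_closed a

/-! ### Gaussian binomial coefficients -/

/-- The finite `q`-Pochhammer product `(1 - q) (1 - q ^ 2) ⋯ (1 - q ^ n)`. -/
def qPoch {K : Type*} [Field K] (q : K) (n : ℕ) : K := ∏ i ∈ range n, (1 - q ^ (i + 1))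

/-- The Gaussian binomial coefficient `(q)_n / ((q)_k (q)_{n-k})`, which is `0` for `k > n`. The
quotient is meaningful when `q` is not a root of unity. -/
def gaussBinom {K : Type*} [Field K] (q : K) (n k : ℕ) : K :=
  if k ≤ n then qPoch q n / (qPoch q k * qPoch q (n - k)) else 0

theorem qPoch_succ {K : Type*} [Field K] (q : K) (n : ℕ) :
    qPoch q (n + 1) = qPoch q n * (1 - q ^ (n + 1)) := by
  rw [qPoch, prod_range_succ, ← qPoch]

theorem qPoch_ne_zero {K : Type*} [Field K] {q : K} (hq : ∀ n : ℕ, q ^ (n + 1) ≠ 1) (n : ℕ) :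
    qPoch q n ≠ 0 :=
  prod_ne_zero_iff.2 fun i _ => sub_ne_zero.2 (hq i).symm

theorem gaussBinom_zero_right {K : Type*} [Field K] {q : K} (hq : ∀ n : ℕ, q ^ (n + 1) ≠ 1)
    (n : ℕ) : gaussBinom q n 0 = 1 := by
  have := qPoch_ne_zero hq n
  simp [gaussBinom, qPoch] at this ⊢
  exact this

theorem gaussBinom_succ_succ {K : Type*} [Field K] {q : K} (hq : ∀ n : ℕ, q ^ (n + 1) ≠ 1)
    (n k : ℕ) (hk : k ≤ n) :
    gaussBinom q (n + 1) (k + 1) = gaussBinom q n (k + 1) + q ^ (n - k) * gaussBinom q n k := by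
  obtain ⟨d, rfl⟩ := Nat.exists_eq_add_of_le hk
  have h1 := qPoch_ne_zero hq k
  have h3 : (1 : K) - q ^ (k + 1) ≠ 0 := sub_ne_zero.2 (hq k).symm
  obtain _ | d := d
  · have h4 := qPoch_ne_zero hq (k + 1)
    simp only [gaussBinom, add_zero, le_refl, if_true, Nat.sub_self, pow_zero, one_mul]
    simp only [qPoch, range_zero, prod_empty, mul_one] at *
    rw [div_self h4, div_self h1]
    simp
  · have h2 := qPoch_ne_zero hq d
    have h4 : (1 : K) - q ^ (d + 1) ≠ 0 := sub_ne_zero.2 (hq d).symm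
    have e1 : k + (d + 1) + 1 - (k + 1) = d + 1 := by omega
    have e2 : k + (d + 1) - (k + 1) = d := by omega
    have e3 : k + (d + 1) - k = d + 1 := by omega
    have i1 : k + 1 ≤ k + (d + 1) + 1 := by omega
    have i2 : k + 1 ≤ k + (d + 1) := by omega
    have i3 : k ≤ k + (d + 1) := by omega
    simp only [gaussBinom, i1, i2, i3, if_true, e1, e2, e3, qPoch_succ q (k + (d + 1)),
      qPoch_succ q k, qPoch_succ q d]
    field_simp
    ring

/-- The `q`-binomial theorem, read off coefficient by coefficient. -/
theorem coeff_prod_one_add_mul_X {K : Type*} [Field K] {q : K} (hq : ∀ n : ℕ, q ^ (n + 1) ≠ 1)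
    (x : K) (n k : ℕ) :
    (∏ i ∈ range n, (1 + Polynomial.C (x * q ^ i) * Polynomial.X)).coeff k
      = x ^ k * q ^ k.choose 2 * gaussBinom q n k := by
  induction n generalizing k with
  | zero =>
    obtain _ | k := k
    · simp [gaussBinom, qPoch]
    · simp [gaussBinom, Polynomial.coeff_one]
  | succ n ih =>
    rw [prod_range_succ, mul_add, mul_one, Polynomial.coeff_add]
    obtain _ | k := k
    · rw [← mul_assoc, Polynomial.mul_coeff_zero, Polynomial.coeff_X_zero, mul_zero, add_zero, ih,
        gaussBinom_zero_right hq, gaussBinom_zero_right hq]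
    · rw [← mul_assoc, Polynomial.coeff_mul_X, Polynomial.coeff_mul_C, ih, ih]
      rcases le_or_gt k n with hk | hk
      · rw [gaussBinom_succ_succ hq n k hk]
        have h1 : (k + 1).choose 2 = k + k.choose 2 := by
          rw [Nat.choose_succ_succ, Nat.choose_one_right]
        obtain ⟨d, rfl⟩ := Nat.exists_eq_add_of_le hk
        rw [h1, Nat.add_sub_cancel_left]
        ring
      · simp [gaussBinom, show ¬ k ≤ n by omega, show ¬ k + 1 ≤ n by omega,
          show ¬ k + 1 ≤ n + 1 by omega]

theorem prod_range_mul_eq {M : Type*} [CommMonoid M] (t L : ℕ) (f : ℕ → M) :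
    ∏ i ∈ range (t * L), f i = ∏ j : Fin t, ∏ i ∈ range L, f (j + t * i) := by
  rw [mul_comm, ← Fin.prod_univ_eq_prod_range, ← finProdFinEquiv.prod_comp, Fintype.prod_prod_type,
    Finset.prod_comm]
  refine prod_congr rfl fun j _ => ?_
  rw [← Fin.prod_univ_eq_prod_range (fun i => f (j + t * i))]
  rfl

theorem coeff_prod_eq_sum_piFinset {K : Type*} [Field K] {t : ℕ} (p : Fin t → Polynomial K) (L : ℕ)
    (hp : ∀ j, (p j).natDegree < L) (k : ℕ) :
    (∏ j, p j).coeff k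
      = ∑ a ∈ (Fintype.piFinset fun _ : Fin t => range L).filter (fun a => ∑ j, a j = k),
          ∏ j, (p j).coeff (a j) := by
  have h1 : ∏ j, p j = ∏ j, ∑ i ∈ range L, Polynomial.monomial i ((p j).coeff i) :=
    prod_congr rfl fun j _ => (p j).as_sum_range' L (hp j)
  have h2 : ∀ a : Fin t → ℕ, ∏ j, Polynomial.monomial (a j) ((p j).coeff (a j))
      = Polynomial.monomial (∑ j, a j) (∏ j, (p j).coeff (a j)) := by
    intro a
    simp_rw [← Polynomial.C_mul_X_pow_eq_monomial]
    rw [prod_mul_distrib, prod_pow_eq_pow_sum, map_prod]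
  rw [h1, prod_univ_sum, Polynomial.finsetSum_coeff, sum_filter]
  refine sum_congr rfl fun a _ => ?_
  rw [h2, Polynomial.coeff_monomial]

/-- A finite form of the generating function of `t`-cores: splitting a product over `t * L`
consecutive exponents into residue classes modulo `t` and comparing coefficients. -/
theorem gaussBinom_mul_eq_sum {K : Type*} [Field K] {q : K} (hq : ∀ n : ℕ, q ^ (n + 1) ≠ 1)
    {t : ℕ} (ht : 0 < t) (L k : ℕ) :
    q ^ k.choose 2 * gaussBinom q (t * L) k
      = ∑ a ∈ (Fintype.piFinset fun _ : Fin t => range (L + 1)).filter (fun a => ∑ j, a j = k),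
          q ^ abacusWeight a * ∏ j, gaussBinom (q ^ t) L (a j) := by
  have hqt : ∀ n : ℕ, (q ^ t) ^ (n + 1) ≠ 1 := by
    intro n
    obtain ⟨s, rfl⟩ := Nat.exists_eq_add_of_lt ht
    rw [← pow_mul, show (0 + s + 1) * (n + 1) = ((s + 1) * n + s) + 1 by ring]
    exact hq _
  have h1 := coeff_prod_one_add_mul_X hq 1 (t * L) k
  rw [one_pow, one_mul] at h1
  rw [← h1, prod_range_mul_eq, coeff_prod_eq_sum_piFinset _ (L + 1)]
  · refine sum_congr rfl fun a _ => ?_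
    have h2 : ∀ j : Fin t,
        (∏ i ∈ range L, (1 + Polynomial.C (1 * q ^ ((j : ℕ) + t * i)) * Polynomial.X)).coeff (a j)
          = q ^ ((j : ℕ) * a j + t * (a j).choose 2) * gaussBinom (q ^ t) L (a j) := by
      intro j
      have h3 := coeff_prod_one_add_mul_X hqt (q ^ (j : ℕ)) L (a j)
      rw [← pow_mul, ← pow_mul, ← pow_add] at h3
      rw [← h3]
      congr 1
      refine prod_congr rfl fun i _ => ?_
      rw [one_mul, pow_add, pow_mul]
    rw [prod_congr rfl fun j _ => h2 j, prod_mul_distrib, prod_pow_eq_pow_sum, abacusWeight]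
  · intro j
    refine lt_of_le_of_lt (Polynomial.natDegree_prod_le _ _) ?_
    refine lt_of_le_of_lt (sum_le_sum (g := fun _ => 1) fun i _ => ?_) (by simp)
    compute_degree

/-! ### The limit of the Gaussian binomial coefficients -/

theorem pow_succ_ne_one_of_norm_lt_one {K : Type*} [NormedField K] {q : K} (hq : ‖q‖ < 1) (n : ℕ) :
    q ^ (n + 1) ≠ 1 := by
  intro h
  have h1 := congrArg norm h
  rw [norm_pow, norm_one] at h1
  exact (pow_lt_one₀ (norm_nonneg q) hq (Nat.succ_ne_zero n)).ne h1

/-- The infinite product `(1 - q) (1 - q ^ 2) ⋯`. -/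
noncomputable def qPochInf (q : ℂ) : ℂ := ∏' n : ℕ, (1 - q ^ (n + 1))

theorem qPochInf_ne_zero {q : ℂ} (hq : ‖q‖ < 1) : qPochInf q ≠ 0 := by
  have := tprod_one_add_ne_zero_of_summable (f := fun n : ℕ => -q ^ (n + 1)) ?_ ?_
  · simpa [qPochInf, sub_eq_add_neg] using this
  · intro i
    rw [← sub_eq_add_neg]
    exact sub_ne_zero.2 (pow_succ_ne_one_of_norm_lt_one hq i).symm
  · simpa using (summable_nat_add_iff 1).mpr (summable_geometric_of_lt_one (norm_nonneg _) hq)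

theorem tendsto_qPoch {q : ℂ} (hq : ‖q‖ < 1) :
    Tendsto (qPoch q) atTop (𝓝 (qPochInf q)) :=
  (ModularForm.multipliable_one_sub_pow hq).tendsto_prod_tprod_nat

theorem tendsto_gaussBinom {q : ℂ} (hq : ‖q‖ < 1) {u v : ℕ → ℕ} (hu : Tendsto u atTop atTop)
    (hv : Tendsto v atTop atTop) :
    Tendsto (fun m => gaussBinom q (u m + v m) (u m)) atTop (𝓝 (qPochInf q)⁻¹) := by
  have h0 := qPochInf_ne_zero hq
  have h1 := tendsto_qPoch hq
  have h2 := (h1.comp (tendsto_atTop_mono (fun m => Nat.le_add_right (u m) (v m)) hu)).div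
    ((h1.comp hu).mul (h1.comp hv)) (mul_ne_zero h0 h0)
  rw [show qPochInf q / (qPochInf q * qPochInf q) = (qPochInf q)⁻¹ by field_simp] at h2
  refine h2.congr fun m => ?_
  simp [gaussBinom]

theorem exists_norm_gaussBinom_le {q : ℂ} (hq : ‖q‖ < 1) :
    ∃ B : ℝ, ∀ n k, ‖gaussBinom q n k‖ ≤ B := by
  have h0 := qPochInf_ne_zero hq
  have h1 := tendsto_qPoch hq
  obtain ⟨A, hA⟩ := h1.norm.bddAbove_range
  obtain ⟨D, hD⟩ := (h1.inv₀ h0).norm.bddAbove_range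
  have hA' : ∀ n, ‖qPoch q n‖ ≤ A := fun n => hA ⟨n, rfl⟩
  have hD' : ∀ n, ‖(qPoch q n)⁻¹‖ ≤ D := fun n => hD ⟨n, rfl⟩
  have hA0 : 0 ≤ A := (norm_nonneg _).trans (hA' 0)
  have hD0 : 0 ≤ D := (norm_nonneg _).trans (hD' 0)
  refine ⟨A * (D * D), fun n k => ?_⟩
  rw [gaussBinom]
  split_ifs
  · rw [div_eq_mul_inv, mul_inv, norm_mul, norm_mul]
    have := hA' n
    have := hD' k
    have := hD' (n - k)
    gcongr
  · rw [norm_zero]; positivity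

theorem one_le_gaussBinom {q : ℝ} (h0 : 0 ≤ q) (h1 : q < 1) {n k : ℕ} (hk : k ≤ n) :
    1 ≤ gaussBinom q n k := by
  obtain ⟨d, rfl⟩ := Nat.exists_eq_add_of_le' hk
  have hpos : ∀ i : ℕ, 0 < 1 - q ^ (i + 1) := fun i =>
    sub_pos.2 (pow_lt_one₀ h0 h1 (Nat.succ_ne_zero i))
  have hpoch : ∀ n, 0 < qPoch q n := fun n => prod_pos fun i _ => hpos i
  rw [gaussBinom, if_pos hk, Nat.add_sub_cancel, one_le_div (mul_pos (hpoch _) (hpoch _)),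
    mul_comm (qPoch q k)]
  rw [qPoch.eq_1 q (d + k), prod_range_add, ← qPoch]
  refine mul_le_mul_of_nonneg_left ?_ (hpoch d).le
  refine prod_le_prod (fun i _ => (hpos i).le) fun i _ => ?_
  have := pow_le_pow_of_le_one h0 h1.le (show i + 1 ≤ d + i + 1 by omega)
  linarith

/-! ### The generating function of `t`-cores -/

/-- The size of the `t`-core with charge vector `n`, where `n j` is the excess of beads on runner
`j` of the abacus. The division by two is exact. -/
def coreSize {t : ℕ} (n : Fin t → ℤ) : ℤ := ∑ j : Fin t, ((j : ℤ) * n j + t * (n j * (n j - 1) / 2))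

/-- The charge vectors of `t`-cores: integer vectors with coordinate sum zero. -/
abbrev ChargeVector (t : ℕ) : Type := {n : Fin t → ℤ // ∑ j, n j = 0}

theorem neg_le_coreSize_term {t : ℕ} (j : Fin t) (x : ℤ) :
    0 ≤ (j : ℤ) * x + t * (x * (x - 1) / 2) ∧ -x ≤ (j : ℤ) * x + t * (x * (x - 1) / 2) := by
  have hj : (j : ℤ) + 1 ≤ t := by have := j.2; omega
  have hj0 : (0 : ℤ) ≤ j := by omega
  obtain ⟨c, hc⟩ : ∃ c, x * (x - 1) = 2 * c := by
    have := Int.even_mul_pred_self x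
    exact this.exists_two_nsmul.imp fun c h => by simpa using h
  rw [hc, Int.mul_ediv_cancel_left _ (by norm_num)]
  rcases le_or_gt 0 x with hx | hx
  · have hc0 : 0 ≤ c := by
      rcases hx.eq_or_lt with h | h
      · subst h; omega
      · nlinarith
    have : 0 ≤ (j : ℤ) * x + t * c := by positivity
    exact ⟨this, by omega⟩
  · have hc1 : -x ≤ c := by nlinarith
    have h1 : (t : ℤ) * (-x) ≤ t * c := mul_le_mul_of_nonneg_left hc1 (by omega)
    have h2 : ((j : ℤ) + 1) * (-x) ≤ t * (-x) := mul_le_mul_of_nonneg_right hj (by omega)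
    constructor <;> nlinarith

theorem coreSize_nonneg {t : ℕ} (n : Fin t → ℤ) : 0 ≤ coreSize n :=
  sum_nonneg fun j _ => (neg_le_coreSize_term j (n j)).1

theorem neg_coreSize_le {t : ℕ} (n : Fin t → ℤ) (j : Fin t) : -coreSize n ≤ n j := by
  have h1 := (neg_le_coreSize_term j (n j)).2
  have h2 := single_le_sum (f := fun j : Fin t => (j : ℤ) * n j + t * (n j * (n j - 1) / 2))
    (fun j _ => (neg_le_coreSize_term j (n j)).1) (mem_univ j)
  rw [coreSize]
  omega

theorem two_mul_choose_two (k : ℕ) : 2 * (k.choose 2 : ℤ) = k * (k - 1) := by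
  obtain _ | k := k
  · simp
  · have h2 : ((k + 1).choose 2) * 2 = (k + 1) * k := by
      rw [Nat.choose_two_right, Nat.div_mul_cancel]
      · simp
      · simpa [mul_comm] using (Nat.even_mul_succ_self k).two_dvd
    push_cast
    have : ((k + 1).choose 2 : ℤ) * 2 = (k + 1) * k := by exact_mod_cast h2
    linarith

theorem two_mul_sum_fin (t : ℕ) : 2 * ∑ j : Fin t, (j : ℤ) = t * (t - 1) := by
  rw [Fin.sum_univ_eq_sum_range (fun i => (i : ℤ)) t]
  induction t with
  | zero => simp
  | succ t ih => rw [sum_range_succ, mul_add, ih]; push_cast; ring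

/-- Adding `m` beads on each runner changes the weight only by the weight of the empty core. -/
theorem abacusWeight_eq {t m : ℕ} {a : Fin t → ℕ} (ha : ∑ j, a j = t * m) :
    (abacusWeight a : ℤ) = coreSize (fun j => (a j : ℤ) - m) + (t * m).choose 2 := by
  have h1 : 2 * (abacusWeight a : ℤ) = ∑ j : Fin t,
      (2 * (j : ℤ) * a j + t * (a j * (a j - 1))) := by
    rw [abacusWeight]
    push_cast
    rw [mul_sum]
    refine sum_congr rfl fun j _ => ?_
    rw [← two_mul_choose_two]
    ring
  have h2 : 2 * coreSize (fun j => (a j : ℤ) - m)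
      = ∑ j : Fin t, (2 * (j : ℤ) * (a j - m) + t * ((a j - m) * (a j - m - 1))) := by
    rw [coreSize, mul_sum]
    refine sum_congr rfl fun j _ => ?_
    have := Int.mul_ediv_cancel' (Int.even_mul_pred_self ((a j : ℤ) - m)).two_dvd
    linear_combination (t : ℤ) * this
  have h3 := two_mul_choose_two (t * m)
  have h4 : ∑ j : Fin t, (a j : ℤ) = t * m := by exact_mod_cast ha
  have h5 : 2 * (abacusWeight a : ℤ) - 2 * coreSize (fun j => (a j : ℤ) - m)
      = (2 * ∑ j : Fin t, (j : ℤ)) * m + 2 * t * m * (∑ j : Fin t, (a j : ℤ))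
        - t * (t * (m * (m + 1))) := by
    rw [h1, h2, ← sum_sub_distrib, mul_sum, sum_mul, mul_sum, ← sum_add_distrib]
    have h6 : (t : ℤ) * (t * (m * (m + 1))) = ∑ j : Fin t, (t * (m * (m + 1)) : ℤ) := by simp
    rw [h6, ← sum_sub_distrib]
    exact sum_congr rfl fun j _ => by ring
  rw [two_mul_sum_fin, h4] at h5
  push_cast at h3
  linarith

/-- The `t`-cores of `N` are the charge vectors of size `N`. An abacus with `N` beads on each runner
is large enough for all of them, since a charge vector of size `N` has entries at least `-N`. -/
theorem tCoreCount_eq_card_chargeVector {t : ℕ} (ht : 0 < t) (N : ℕ) :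
    tCoreCount t N = Nat.card {n : ChargeVector t // (coreSize n.1).toNat = N} := by
  rw [tCoreCount_eq_card_abacus ht (Nat.le_mul_of_pos_left N ht), ← Nat.card_coe_set_eq]
  refine Nat.card_congr
    { toFun := fun a => ⟨⟨fun j => (a.1 j : ℤ) - N, ?_⟩, ?_⟩
      invFun := fun n => ⟨fun j => (n.1.1 j + N).toNat, ?_, ?_⟩
      left_inv := ?_
      right_inv := ?_ }
  · have h : ∑ j, (a.1 j : ℤ) = t * N := by exact_mod_cast a.2.1
    simp [sum_sub_distrib, h]
  · have h1 := abacusWeight_eq a.2.1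
    rw [a.2.2] at h1
    push_cast at h1
    simp only
    omega
  all_goals
    have key : ∀ (n : {n : ChargeVector t // (coreSize n.1).toNat = N}) (j : Fin t),
        (((n.1.1 j + N).toNat : ℕ) : ℤ) = n.1.1 j + N := by
      intro n j
      have h1 := neg_coreSize_le n.1.1 j
      have h2 := n.2
      omega
  · zify
    rw [sum_congr rfl fun j _ => key n j, sum_add_distrib, n.1.2]
    simp
  · have h1 : ∑ j : Fin t, (n.1.1 j + N).toNat = t * N := by
      zify
      rw [sum_congr rfl fun j _ => key n j, sum_add_distrib, n.1.2]
      simp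
    have h2 := abacusWeight_eq h1
    simp only [key, add_sub_cancel_right] at h2
    rw [show (fun j => n.1.1 j) = n.1.1 from rfl] at h2
    have h3 := n.2
    have h4 := coreSize_nonneg n.1.1
    omega
  · intro a
    ext j
    simp
  · intro n
    refine Subtype.ext (Subtype.ext (funext fun j => ?_))
    simp only [key, add_sub_cancel_right]

/-- The truncation to charges in `[-m, m]`, with Gaussian weights, of the generating function of
`t`-cores. -/
def truncTerm {K : Type*} [Field K] (t : ℕ) (q : K) (m : ℕ) (n : ChargeVector t) : K :=
  if ∀ j, |n.1 j| ≤ m then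
    q ^ (coreSize n.1).toNat * ∏ j, gaussBinom (q ^ t) (2 * m) (n.1 j + m).toNat else 0

theorem hasSum_truncTerm {K : Type*} [NormedField K] {q : K} (hq0 : q ≠ 0)
    (hq : ∀ n : ℕ, q ^ (n + 1) ≠ 1) {t : ℕ} (ht : 0 < t) (m : ℕ) :
    HasSum (truncTerm t q m) (gaussBinom q (t * (2 * m)) (t * m)) := by
  set A := (Fintype.piFinset fun _ : Fin t => range (2 * m + 1)).filter
    (fun a => ∑ j, a j = t * m) with hA
  have hAmem : ∀ a, a ∈ A ↔ (∀ j, a j < 2 * m + 1) ∧ ∑ j, a j = t * m := by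
    intro a
    simp [hA]
  let i : A → ChargeVector t := fun a => ⟨fun j => (a.1 j : ℤ) - m, by
    have h : ∑ j, (a.1 j : ℤ) = t * m := by exact_mod_cast ((hAmem a.1).1 a.2).2
    simp [sum_sub_distrib, h]⟩
  have hi : Function.Injective i := by
    intro a b h
    refine Subtype.ext (funext fun j => ?_)
    have := congrFun (congrArg Subtype.val h) j
    simp only [i] at this
    omega
  have hout : ∀ n ∉ Set.range i, truncTerm t q m n = 0 := by
    intro n hn
    rw [truncTerm, if_neg]
    intro hle
    refine hn ⟨⟨fun j => (n.1 j + m).toNat, ?_⟩, ?_⟩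
    · refine (hAmem _).2 ⟨fun j => ?_, ?_⟩
      · have := abs_le.1 (hle j)
        omega
      · zify
        have : ∀ j, (((n.1 j + m).toNat : ℕ) : ℤ) = n.1 j + m := fun j => by
          have := abs_le.1 (hle j)
          omega
        rw [sum_congr rfl fun j _ => this j, sum_add_distrib, n.2]
        simp
    · refine Subtype.ext (funext fun j => ?_)
      have := abs_le.1 (hle j)
      simp only [i]
      omega
  rw [← hi.hasSum_iff hout]
  have h1 := gaussBinom_mul_eq_sum hq ht (2 * m) (t * m)
  have h2 : gaussBinom q (t * (2 * m)) (t * m) = ∑ a : A, (truncTerm t q m ∘ i) a := by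
    refine mul_left_cancel₀ (pow_ne_zero ((t * m).choose 2) hq0) ?_
    rw [h1, ← hA, ← sum_coe_sort A, mul_sum]
    refine sum_congr rfl fun a _ => ?_
    have ha := (hAmem a.1).1 a.2
    have h3 : ∀ j, |(i a).1 j| ≤ m := fun j => by
      have := ha.1 j
      simp only [i, abs_le]
      omega
    have h4 : abacusWeight a.1 = (t * m).choose 2 + (coreSize (i a).1).toNat := by
      have h5 := abacusWeight_eq ha.2
      have h6 := coreSize_nonneg (i a).1
      change (abacusWeight a.1 : ℤ) = coreSize (i a).1 + (t * m).choose 2 at h5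
      omega
    rw [Function.comp_apply, truncTerm, if_pos h3, ← mul_assoc, ← pow_add, h4]
    simp [i]
  rw [h2]
  exact hasSum_fintype _

/-- For `0 < r < 1` the Gaussian weights in `truncTerm` are at least `1`, so that every finite sum
is bounded by a Gaussian binomial coefficient, and these are bounded. -/
theorem summable_pow_coreSize {r : ℝ} (h0 : 0 < r) (h1 : r < 1) {t : ℕ} (ht : 0 < t) :
    Summable fun n : ChargeVector t => r ^ (coreSize n.1).toNat := by
  have hr : ‖(r : ℂ)‖ < 1 := by rwa [Complex.norm_real, Real.norm_of_nonneg h0.le]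
  obtain ⟨B, hB⟩ := exists_norm_gaussBinom_le hr
  have hB' : ∀ n k, gaussBinom r n k ≤ B := by
    intro n k
    refine le_trans (le_abs_self _) (le_trans (le_of_eq ?_) (hB n k))
    rw [← Real.norm_eq_abs, ← Complex.norm_real]
    congr 1
    simp only [gaussBinom, qPoch]
    split_ifs <;> push_cast <;> rfl
  have hrt0 : 0 ≤ r ^ t := by positivity
  have hrt1 : r ^ t < 1 := pow_lt_one₀ h0.le h1 ht.ne'
  have hrn : ∀ n : ℕ, r ^ (n + 1) ≠ 1 := fun n =>
    (pow_lt_one₀ h0.le h1 (Nat.succ_ne_zero n)).ne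
  refine summable_of_sum_le (c := B) (fun n => by positivity) fun u => ?_
  obtain ⟨m, hm⟩ : ∃ m : ℕ, ∀ n ∈ u, ∀ j, |n.1 j| ≤ m := by
    refine ⟨∑ n ∈ u, ∑ j, (n.1 j).natAbs, fun n hn j => ?_⟩
    have h2 : (n.1 j).natAbs ≤ ∑ j, (n.1 j).natAbs :=
      single_le_sum (f := fun j => (n.1 j).natAbs) (fun _ _ => Nat.zero_le _) (mem_univ j)
    have h3 : ∑ j, (n.1 j).natAbs ≤ ∑ n ∈ u, ∑ j, (n.1 j).natAbs :=
      single_le_sum (f := fun n : ChargeVector t => ∑ j, (n.1 j).natAbs)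
        (fun _ _ => Nat.zero_le _) hn
    rw [Int.abs_eq_natAbs]
    omega
  have hS := hasSum_truncTerm h0.ne' hrn ht m
  have hle : ∀ n : ChargeVector t, (∀ j, |n.1 j| ≤ m) →
      r ^ (coreSize n.1).toNat ≤ truncTerm t r m n := by
    intro n hn
    rw [truncTerm, if_pos hn]
    refine le_mul_of_one_le_right (by positivity) ?_
    refine prod_const_one.symm.le.trans (prod_le_prod (fun _ _ => zero_le_one) fun j _ => ?_)
    have := abs_le.1 (hn j)
    exact one_le_gaussBinom hrt0 hrt1 (by omega)
  calc ∑ n ∈ u, r ^ (coreSize n.1).toNat ≤ ∑ n ∈ u, truncTerm t r m n :=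
        sum_le_sum fun n hn => hle n (hm n hn)
    _ ≤ gaussBinom r (t * (2 * m)) (t * m) := by
        refine sum_le_hasSum _ (fun n _ => ?_) hS
        by_cases hn : ∀ j, |n.1 j| ≤ m
        · exact (by positivity : (0 : ℝ) ≤ _).trans (hle n hn)
        · rw [truncTerm, if_neg hn]
    _ ≤ B := hB' _ _

/-- The limit `m → ∞` in `hasSum_truncTerm`, by dominated convergence. -/
theorem hasSum_pow_coreSize {q : ℂ} (hq0 : q ≠ 0) (hq : ‖q‖ < 1) {t : ℕ} (ht : 0 < t) :
    HasSum (fun n : ChargeVector t => q ^ (coreSize n.1).toNat)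
      (qPochInf (q ^ t) ^ t / qPochInf q) := by
  have hqt : ‖q ^ t‖ < 1 := by
    rw [norm_pow]
    exact pow_lt_one₀ (norm_nonneg _) hq ht.ne'
  have hne := qPochInf_ne_zero hqt
  obtain ⟨B, hB⟩ := exists_norm_gaussBinom_le hqt
  have hB0 : 0 ≤ B := (norm_nonneg _).trans (hB 0 0)
  have hsum := summable_pow_coreSize (norm_pos_iff.2 hq0) hq ht
  have hT : Tendsto (fun m => ∑' n, truncTerm t q m n) atTop
      (𝓝 (∑' n : ChargeVector t,
        q ^ (coreSize n.1).toNat * ((qPochInf (q ^ t))⁻¹) ^ t)) := by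
    refine tendsto_tsum_of_dominated_convergence
      (bound := fun n => ‖q‖ ^ (coreSize n.1).toNat * B ^ t) (hsum.mul_right _) ?_ ?_
    · intro n
      have hlim : Tendsto (fun m : ℕ => q ^ (coreSize n.1).toNat *
          ∏ j, gaussBinom (q ^ t) (2 * m) (n.1 j + m).toNat) atTop
          (𝓝 (q ^ (coreSize n.1).toNat * ∏ _j : Fin t, (qPochInf (q ^ t))⁻¹)) := by
        refine Tendsto.const_mul _ (tendsto_finsetProd _ fun j _ => ?_)
        have hu : Tendsto (fun m : ℕ => (n.1 j + m).toNat) atTop atTop := by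
          refine tendsto_atTop.2 fun b => ?_
          filter_upwards [eventually_ge_atTop (b + (n.1 j).natAbs)] with m hm
          omega
        have hv : Tendsto (fun m : ℕ => 2 * m - (n.1 j + m).toNat) atTop atTop := by
          refine tendsto_atTop.2 fun b => ?_
          filter_upwards [eventually_ge_atTop (b + (n.1 j).natAbs)] with m hm
          omega
        refine (tendsto_gaussBinom hqt hu hv).congr' ?_
        filter_upwards [eventually_ge_atTop (n.1 j).natAbs] with m hm
        congr 1
        omega
      rw [prod_const, card_univ, Fintype.card_fin] at hlim
      refine hlim.congr' ?_
      filter_upwards [eventually_ge_atTop (∑ j, (n.1 j).natAbs)] with m hm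
      rw [truncTerm, if_pos]
      intro j
      have : (n.1 j).natAbs ≤ ∑ j, (n.1 j).natAbs :=
        single_le_sum (f := fun j => (n.1 j).natAbs) (fun _ _ => Nat.zero_le _) (mem_univ j)
      rw [Int.abs_eq_natAbs]
      omega
    · refine Eventually.of_forall fun m n => ?_
      rw [truncTerm]
      split_ifs
      · rw [norm_mul, norm_pow, norm_prod]
        gcongr
        refine (prod_le_prod (fun _ _ => norm_nonneg _) fun j _ => hB _ _).trans_eq ?_
        simp
      · rw [norm_zero]; positivity
  have hG : Tendsto (fun m => ∑' n, truncTerm t q m n) atTop (𝓝 (qPochInf q)⁻¹) := by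
    have htm : Tendsto (fun m => t * m) atTop atTop := tendsto_id.const_mul_atTop' ht
    refine (tendsto_gaussBinom hq htm htm).congr fun m => ?_
    rw [(hasSum_truncTerm hq0 (pow_succ_ne_one_of_norm_lt_one hq) ht m).tsum_eq]
    congr 1
    ring
  have hE := tendsto_nhds_unique hT hG
  rw [tsum_mul_right] at hE
  have hs : Summable fun n : ChargeVector t => q ^ (coreSize n.1).toNat :=
    Summable.of_norm (by simpa using hsum)
  refine (hs.hasSum_iff).2 ?_
  have h2 := pow_ne_zero t hne
  rw [inv_pow] at hE
  rw [div_eq_mul_inv, ← hE]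
  field_simp

/-- The generating function of `t`-cores is `∏ (1 - q ^ (t * n)) ^ t / (1 - q ^ n)`. -/
theorem hasSum_tCoreCount {q : ℂ} (hq0 : q ≠ 0) (hq : ‖q‖ < 1) {t : ℕ} (ht : 0 < t) :
    HasSum (fun N : ℕ => (tCoreCount t N : ℂ) * q ^ N) (qPochInf (q ^ t) ^ t / qPochInf q) := by
  have h := (hasSum_pow_coreSize hq0 hq ht).tsum_fiberwise
    (fun n : ChargeVector t => (coreSize n.1).toNat)
  have hf : ∀ N : ℕ, ∑' b : (fun n : ChargeVector t => (coreSize n.1).toNat) ⁻¹' {N},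
      q ^ (coreSize b.1.1).toNat = (tCoreCount t N : ℂ) * q ^ N := by
    intro N
    rw [tsum_congr (g := fun _ => q ^ N) fun b => by
      rw [show (coreSize b.1.1).toNat = N from b.2],
      tsum_const, tCoreCount_eq_card_chargeVector ht, nsmul_eq_mul]
    rfl
  simp only [hf] at h
  exact h

theorem summable_tCoreCount {r : ℝ} (h0 : 0 < r) (h1 : r < 1) {t : ℕ} (ht : 0 < t) :
    Summable fun N : ℕ => (tCoreCount t N : ℝ) * r ^ N := by
  have hr : ‖(r : ℂ)‖ < 1 := by rwa [Complex.norm_real, Real.norm_of_nonneg h0.le]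
  have h := (hasSum_tCoreCount (Complex.ofReal_ne_zero.2 h0.ne') hr ht).summable
  refine Complex.summable_ofReal.1 (h.congr fun N => ?_)
  push_cast
  rfl

end Combinatorics

section CircleMethod

open Filter Topology MeasureTheory Complex
open UpperHalfPlane hiding I
open scoped Real MatrixGroups ModularForm Modular FourierTransform

/-! ### The eta quotient and its Fourier coefficients -/

/-- The eta quotient `η(t z) ^ t / η(z)`, the generating function of `t`-cores up to a power of
`e ^ (2 π i z)`. -/
noncomputable def coreQuot (t : ℕ) (z : ℂ) : ℂ := η (t * z) ^ t / η z

theorem eta_eq_qPochInf (z : ℂ) :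
    η z = cexp (2 * π * I * z / 24) * qPochInf (cexp (2 * π * I * z)) := by
  simp [ModularForm.eta, qPochInf, Function.Periodic.qParam, ModularForm.eta_q]

theorem norm_cexp_two_pi_I_mul (z : ℂ) : ‖cexp (2 * π * I * z)‖ = Real.exp (-(2 * π * z.im)) := by
  rw [Complex.norm_exp]
  congr 1
  simp

theorem norm_cexp_two_pi_I_mul_lt_one {z : ℂ} (hz : 0 < z.im) : ‖cexp (2 * π * I * z)‖ < 1 := by
  rw [norm_cexp_two_pi_I_mul, Real.exp_lt_one_iff]
  have := Real.pi_pos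
  simp only [Left.neg_neg_iff]
  positivity

theorem hasSum_coreQuot {t : ℕ} (ht : 0 < t) (N : ℕ) {z : ℂ} (hz : 0 < z.im) :
    HasSum (fun n : ℕ => (tCoreCount t n : ℂ) * cexp (2 * π * I * ((n : ℂ) - N) * z))
      (coreQuot t z * cexp (-(2 * π * I * shiftedSize t N * z))) := by
  set q := cexp (2 * π * I * z) with hq
  have h := hasSum_tCoreCount (q := q) (Complex.exp_ne_zero _) (norm_cexp_two_pi_I_mul_lt_one hz) ht
  have hqt : cexp (2 * π * I * (t * z)) = q ^ t := by
    rw [hq, ← Complex.exp_nat_mul]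
    congr 1
    ring
  have h1 : coreQuot t z * cexp (-(2 * π * I * shiftedSize t N * z))
      = qPochInf (q ^ t) ^ t / qPochInf q * cexp (-(2 * π * I * N * z)) := by
    have h2 : cexp (2 * π * I * (t * z) / 24) ^ t * cexp (-(2 * π * I * shiftedSize t N * z))
        = cexp (2 * π * I * z / 24) * cexp (-(2 * π * I * N * z)) := by
      rw [← Complex.exp_nat_mul, ← Complex.exp_add, ← Complex.exp_add]
      congr 1
      rw [shiftedSize]
      push_cast
      ring
    rw [coreQuot, eta_eq_qPochInf, eta_eq_qPochInf, hqt, mul_pow, ← hq]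
    have h3 := Complex.exp_ne_zero (2 * π * I * z / 24)
    rw [mul_div_mul_comm, mul_right_comm, div_mul_eq_mul_div, h2, mul_div_cancel_left₀ _ h3,
      mul_comm]
  rw [h1]
  refine (h.mul_right _).congr_fun fun n => ?_
  rw [mul_assoc (tCoreCount t n : ℂ), hq, ← Complex.exp_nat_mul, ← Complex.exp_add]
  congr 2
  ring

theorem integral_cexp_int (k : ℤ) (a y : ℝ) :
    ∫ x in a..a + 1, cexp (2 * π * I * k * (x + y * I)) = if k = 0 then 1 else 0 := by
  split_ifs with hk
  · simp [hk]
  · have hc : 2 * π * I * (k : ℂ) ≠ 0 := by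
      have : (k : ℂ) ≠ 0 := Int.cast_ne_zero.2 hk
      have := Real.pi_ne_zero
      simp [*]
    simp_rw [mul_add, Complex.exp_add]
    rw [intervalIntegral.integral_mul_const, integral_exp_mul_complex hc]
    have : cexp (2 * π * I * k * ((a + 1 : ℝ) : ℂ)) = cexp (2 * π * I * k * (a : ℂ)) := by
      rw [Complex.exp_eq_exp_iff_exists_int]
      exact ⟨k, by push_cast; ring⟩
    rw [this]
    simp

/-- The number of `t`-cores of `N` as a Fourier coefficient of the eta quotient. -/
theorem tCoreCount_eq_integral {t : ℕ} (ht : 0 < t) (N : ℕ) (a : ℝ) {y : ℝ} (hy : 0 < y) :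
    (tCoreCount t N : ℂ) = ∫ x in a..a + 1, coreQuot t (x + y * I)
      * cexp (-(2 * π * I * shiftedSize t N * (x + y * I))) := by
  have him : ∀ x : ℝ, 0 < ((x : ℂ) + y * I).im := fun x => by simpa using hy
  have hr1 : Real.exp (-(2 * π * y)) < 1 := by
    have := Real.pi_pos
    rw [Real.exp_lt_one_iff]
    simp only [Left.neg_neg_iff]
    positivity
  have hs := (summable_tCoreCount (Real.exp_pos (-(2 * π * y))) hr1 ht).mul_right
    (Real.exp (2 * π * N * y))
  have hnorm : ∀ (n : ℕ) (x : ℝ),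
      ‖(tCoreCount t n : ℂ) * cexp (2 * π * I * ((n : ℂ) - N) * (x + y * I))‖
        = tCoreCount t n * Real.exp (-(2 * π * y)) ^ n * Real.exp (2 * π * N * y) := by
    intro n x
    rw [norm_mul, Complex.norm_natCast, Complex.norm_exp, ← Real.exp_nat_mul,
      mul_assoc (tCoreCount t n : ℝ), ← Real.exp_add]
    congr 2
    simp
    ring
  have h := intervalIntegral.hasSum_integral_of_dominated_convergence (a := a) (b := a + 1)
    (μ := volume)
    (F := fun (n : ℕ) (x : ℝ) => (tCoreCount t n : ℂ) * cexp
        (2 * π * I * ((n : ℂ) - N) * (x + y * I)))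
    (f := fun x : ℝ => coreQuot t (x + y * I) * cexp (-(2 * π * I * shiftedSize t N * (x + y * I))))
    (fun n _ => tCoreCount t n * Real.exp (-(2 * π * y)) ^ n * Real.exp (2 * π * N * y))
    (fun n => (by fun_prop : Continuous _).aestronglyMeasurable)
    (fun n => Eventually.of_forall fun x _ => (hnorm n x).le)
    (Eventually.of_forall fun x _ => hs)
    intervalIntegrable_const
    (Eventually.of_forall fun x _ => hasSum_coreQuot ht N (him x))
  refine HasSum.unique ?_ h
  refine (hasSum_ite_eq N (tCoreCount t N : ℂ)).congr_fun fun n => ?_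
  rw [intervalIntegral.integral_const_mul]
  have h2 := integral_cexp_int ((n : ℤ) - N) a y
  push_cast at h2
  rw [h2]
  by_cases hn : n = N
  · simp [hn]
  · rw [if_neg (by omega), if_neg hn, mul_zero]

/-! ### The transformation at the cusp zero -/

theorem log_neg_I_mul {w : ℂ} (hw : 0 < w.im) : log (-I * w) = log w - log I := by
  have hw0 : w ≠ 0 := fun h => by simp [h] at hw
  have h1 : log (-I * w) = log (-I) + log w := by
    rw [Complex.log_mul_eq_add_log_iff (neg_ne_zero.2 I_ne_zero) hw0, Complex.arg_neg_I]
    have h2 := Complex.arg_nonneg_iff.2 hw.le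
    have h3 := Complex.arg_le_pi w
    have := Real.pi_pos
    constructor <;> linarith
  rw [h1, Complex.log_neg_I, Complex.log_I]
  ring

theorem eta_eq_cexp_mul {w : ℂ} (hw : 0 < w.im) :
    η w = cexp (-(log (-I * w) / 2)) * η (-1 / w) := by
  have hw0 : w ≠ 0 := fun h => by simp [h] at hw
  have h := ModularForm.eta_comp_eq_csqrt_I_inv hw
  simp only [Function.comp_apply, Pi.smul_apply, Pi.mul_apply, smul_eq_mul] at h
  rw [h, sqrt_eq_exp I_ne_zero, sqrt_eq_exp hw0, log_neg_I_mul hw, ← Complex.exp_neg,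
    ← mul_assoc, ← mul_assoc, ← Complex.exp_add, ← Complex.exp_add]
  rw [show -((log w - log I) / 2) + -(log I / 2) + log w / 2 = 0 by ring, Complex.exp_zero, one_mul]

/-- The correction factor at the cusp zero, a product close to `1` near the cusp. -/
noncomputable def cuspFactor (t : ℕ) (z : ℂ) : ℂ :=
  qPochInf (cexp (2 * π * I * (-1 / (t * z)))) ^ t / qPochInf (cexp (2 * π * I * (-1 / z)))

theorem coreQuot_eq_cuspFactor {t : ℕ} (ht : 0 < t) {z : ℂ} (hz : 0 < z.im) :
    coreQuot t z = (((t : ℝ) ^ (-((t : ℝ) / 2)) : ℝ) : ℂ)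
      * (-I * z) ^ (-((((t : ℝ) - 1) / 2 : ℝ) : ℂ)) * cuspFactor t z := by
  have hz0 : z ≠ 0 := fun h => by simp [h] at hz
  have ht' : (0 : ℝ) < t := by exact_mod_cast ht
  have htc : (t : ℂ) ≠ 0 := by exact_mod_cast ht.ne'
  have htz : 0 < ((t : ℂ) * z).im := by
    rw [← Complex.ofReal_natCast, Complex.im_ofReal_mul]
    positivity
  have hlog : log (-I * (t * z)) = Real.log t + log (-I * z) := by
    rw [show -I * (t * z) = ((t : ℝ) : ℂ) * (-I * z) by push_cast; ring,
      Complex.log_ofReal_mul ht' (by simp [hz0])]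
  have hpow : (((t : ℝ) ^ (-((t : ℝ) / 2)) : ℝ) : ℂ) = cexp (-(t / 2) * Real.log t) := by
    rw [Real.rpow_def_of_pos ht']
    push_cast
    congr 1
    ring
  rw [coreQuot, cuspFactor, eta_eq_cexp_mul hz, eta_eq_cexp_mul htz, hlog, eta_eq_qPochInf,
    eta_eq_qPochInf, hpow, Complex.cpow_def_of_ne_zero (by simp [hz0])]
  have e1 : cexp (2 * π * I * (-1 / (t * z)) / 24) ^ t = cexp (2 * π * I * (-1 / z) / 24) := by
    rw [← Complex.exp_nat_mul]
    congr 1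
    field_simp
  have e2 : cexp (-((Real.log t + log (-I * z)) / 2)) ^ t
      = cexp (-(t / 2) * Real.log t) * cexp (log (-I * z) * -((((t : ℝ) - 1) / 2 : ℝ) : ℂ))
        * cexp (-(log (-I * z) / 2)) := by
    rw [← Complex.exp_nat_mul, ← Complex.exp_add, ← Complex.exp_add]
    congr 1
    push_cast
    ring
  rw [mul_pow, mul_pow, e1, e2]
  have n1 := Complex.exp_ne_zero (-(log (-I * z) / 2))
  have n2 := Complex.exp_ne_zero (2 * π * I * (-1 / z) / 24)
  have n3 : qPochInf (cexp (2 * π * I * (-1 / z))) ≠ 0 :=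
    qPochInf_ne_zero (norm_cexp_two_pi_I_mul_lt_one (by
      rw [neg_div, one_div, Complex.neg_im, Complex.inv_im, neg_div, neg_neg]
      have := Complex.normSq_pos.2 hz0
      positivity))
  field_simp

/-! ### Bounds for the infinite product -/

theorem norm_qPochInf_sub_one_le {q : ℂ} (hq : ‖q‖ < 1) :
    ‖qPochInf q - 1‖ ≤ Real.exp (‖q‖ / (1 - ‖q‖)) - 1 := by
  refine le_of_tendsto ((tendsto_qPoch hq).sub_const 1).norm (Eventually.of_forall fun n => ?_)
  have h := Finset.norm_prod_one_add_sub_one_le (Finset.range n) (fun i : ℕ => -q ^ (i + 1))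
  simp only [← sub_eq_add_neg, norm_neg, norm_pow] at h
  refine h.trans (sub_le_sub_right (Real.exp_le_exp.2 ?_) 1)
  have hg : Summable fun i : ℕ => ‖q‖ ^ i := summable_geometric_of_lt_one (norm_nonneg _) hq
  calc ∑ i ∈ Finset.range n, ‖q‖ ^ (i + 1) = ‖q‖ * ∑ i ∈ Finset.range n, ‖q‖ ^ i := by
        rw [Finset.mul_sum]
        exact Finset.sum_congr rfl fun i _ => pow_succ' _ _
    _ ≤ ‖q‖ * (1 - ‖q‖)⁻¹ := by
        gcongr
        rw [← tsum_geometric_of_lt_one (norm_nonneg _) hq]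
        exact hg.sum_le_tsum _ fun i _ => by positivity
    _ = ‖q‖ / (1 - ‖q‖) := (div_eq_mul_inv _ _).symm

theorem norm_qPochInf_le {q : ℂ} (hq : ‖q‖ < 1) : ‖qPochInf q‖ ≤ Real.exp (‖q‖ / (1 - ‖q‖)) := by
  have h := norm_qPochInf_sub_one_le hq
  have h2 := norm_add_le (qPochInf q - 1) 1
  rw [sub_add_cancel, norm_one] at h2
  linarith

theorem norm_qPochInf_sub_one_le_two_mul {q : ℂ} (hq : ‖q‖ ≤ 1 / 5) :
    ‖qPochInf q - 1‖ ≤ 2 * ‖q‖ := by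
  refine (norm_qPochInf_sub_one_le (by linarith)).trans ?_
  set r := ‖q‖ with hr
  have hr0 : 0 ≤ r := norm_nonneg q
  have h1 : r / (1 - r) ≤ 5 / 4 * r := by
    rw [div_le_iff₀ (by linarith)]
    nlinarith
  have h2 := Real.abs_exp_sub_one_sub_id_le (x := 5 / 4 * r) (by
    rw [abs_of_nonneg (by positivity)]; linarith)
  have h3 := (abs_le.1 h2).2
  have h4 := Real.exp_le_exp.2 h1
  nlinarith

/-! ### An invariant bound for the eta function -/

/-- The `SL(2, ℤ)`-invariant function `(im τ) ^ (1 / 4) * |η(τ)|`. -/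
noncomputable def etaNorm (τ : ℍ) : ℝ := τ.im ^ (1 / 4 : ℝ) * ‖η (τ : ℂ)‖

theorem etaNorm_pos (τ : ℍ) : 0 < etaNorm τ :=
  mul_pos (Real.rpow_pos_of_pos τ.im_pos _) (norm_pos_iff.2 (ModularForm.eta_ne_zero τ.2))

/-- The `48`-th power of `etaNorm` is the Petersson function of the cusp form `Δ = η ^ 24`, which is
why `etaNorm` is invariant and bounded. -/
theorem etaNorm_pow_eq_petersson (τ : ℍ) :
    etaNorm τ ^ 48 = ‖petersson 12 ModularForm.discriminant ModularForm.discriminant τ‖ := by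
  have h1 : (τ.im ^ (1 / 4 : ℝ)) ^ 48 = τ.im ^ 12 := by
    rw [← Real.rpow_natCast, ← Real.rpow_mul τ.im_pos.le, ← Real.rpow_natCast]
    norm_num
  rw [etaNorm, mul_pow, h1, petersson, norm_mul, norm_mul, Complex.norm_conj,
    ModularForm.discriminant, norm_pow, norm_zpow, Complex.norm_real,
    Real.norm_of_nonneg τ.im_pos.le, ← pow_add, mul_comm]
  norm_cast

theorem etaNorm_smul (γ : SL(2, ℤ)) (τ : ℍ) : etaNorm (γ • τ) = etaNorm τ := by
  have h : etaNorm (γ • τ) ^ 48 = etaNorm τ ^ 48 := by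
    rw [etaNorm_pow_eq_petersson, etaNorm_pow_eq_petersson, ← petersson_slash_SL,
      SlashInvariantForm.slash_action_generators_SL2Z ModularForm.discriminant_S_invariant
        ModularForm.discriminant_T_invariant γ]
  exact (pow_left_inj₀ (etaNorm_pos _).le (etaNorm_pos _).le (by norm_num)).1 h

theorem exists_etaNorm_le : ∃ B : ℝ, 1 ≤ B ∧ ∀ τ, etaNorm τ ≤ B := by
  obtain ⟨C, hC⟩ := CuspFormClass.petersson_bounded_left 12 𝒮ℒ CuspForm.discriminant
    CuspForm.discriminant
  refine ⟨max 1 C, le_max_left _ _, fun τ => ?_⟩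
  have h := hC τ
  rw [CuspForm.coe_discriminant, ← etaNorm_pow_eq_petersson] at h
  rcases le_or_gt (etaNorm τ) 1 with h1 | h1
  · exact h1.trans (le_max_left _ _)
  · exact ((le_self_pow₀ h1.le (by norm_num)).trans h).trans (le_max_right _ _)

theorem etaNorm_eq (τ : ℍ) : etaNorm τ = τ.im ^ (1 / 4 : ℝ) * Real.exp (-(π / 12 * τ.im))
    * ‖qPochInf (cexp (2 * π * I * τ))‖ := by
  rw [etaNorm, eta_eq_qPochInf, norm_mul, ← mul_assoc]
  congr 2
  rw [Complex.norm_exp]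
  congr 1
  rw [show 2 * π * I * (τ : ℂ) / 24 = ((π / 12 : ℝ) : ℂ) * (I * τ) by push_cast; ring,
    Complex.re_ofReal_mul]
  simp

theorem exp_neg_two_pi_le : Real.exp (-(2 * π)) ≤ 1 / 250 := by
  rw [Real.exp_neg, one_div]
  refine inv_anti₀ (by norm_num) ?_
  have h1 : Real.exp 1 ^ 6 ≤ Real.exp (2 * π) := by
    rw [← Real.exp_nat_mul]
    refine Real.exp_le_exp.2 ?_
    have := Real.pi_gt_three
    push_cast
    linarith
  have h2 : (2.7 : ℝ) ^ 6 ≤ Real.exp 1 ^ 6 :=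
    pow_le_pow_left₀ (by norm_num) (by have := Real.exp_one_gt_d9; linarith) _
  have h3 : (250 : ℝ) ≤ 2.7 ^ 6 := by norm_num
  linarith

theorem etaNorm_le_of_one_le_im {τ : ℍ} (h : 1 ≤ τ.im) :
    etaNorm τ ≤ τ.im ^ (1 / 4 : ℝ) * Real.exp (-(π / 12 * τ.im)) * Real.exp (1 / 200) := by
  rw [etaNorm_eq]
  have hq : ‖cexp (2 * π * I * τ)‖ ≤ 1 / 250 := by
    rw [norm_cexp_two_pi_I_mul]
    refine (Real.exp_le_exp.2 ?_).trans exp_neg_two_pi_le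
    have := Real.pi_pos
    rw [UpperHalfPlane.coe_im]
    nlinarith
  gcongr
  refine (norm_qPochInf_le (by linarith)).trans (Real.exp_le_exp.2 ?_)
  rw [div_le_iff₀ (by linarith)]
  linarith

theorem le_etaNorm_of_half_le_im {τ : ℍ} (h : 1 / 2 ≤ τ.im) :
    τ.im ^ (1 / 4 : ℝ) * Real.exp (-(π / 12 * τ.im)) * (1 / 2) ≤ etaNorm τ := by
  rw [etaNorm_eq]
  have hq : ‖cexp (2 * π * I * τ)‖ ≤ 1 / 5 := by
    rw [norm_cexp_two_pi_I_mul]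
    have h1 : Real.exp (-(2 * π * (τ : ℂ).im)) ≤ Real.exp (-3) := by
      refine Real.exp_le_exp.2 ?_
      have := Real.pi_gt_three
      rw [UpperHalfPlane.coe_im]
      nlinarith
    refine h1.trans ?_
    rw [Real.exp_neg, one_div]
    refine inv_anti₀ (by norm_num) ?_
    have := Real.quadratic_le_exp_of_nonneg (x := 3) (by norm_num)
    linarith
  have h2 := norm_qPochInf_sub_one_le_two_mul hq
  have h3 := norm_sub_norm_le (1 : ℂ) (qPochInf (cexp (2 * π * I * τ)))
  rw [norm_one, norm_sub_rev] at h3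
  gcongr
  linarith

/-! ### The eta quotient away from the cusp zero -/

/-- If `γ` has bottom row `(c, d)`, a matrix with bottom row `(c, t d) / gcd (c, t d)` moves `t z`
at least as high as `im (γ z) / t`. -/
theorem exists_smul_im_ge {t : ℕ} (ht : 0 < t) {z w : ℍ} (hw : (w : ℂ) = t * z) (γ : SL(2, ℤ)) :
    ∃ γ' : SL(2, ℤ), (γ • z).im / t ≤ (γ' • w).im := by
  set c := γ 1 0 with hc
  set d := γ 1 1 with hd
  have hcop : IsCoprime c d := ModularGroup.bottom_row_coprime γ
  have hpos : 0 < Int.gcd c (t * d) := by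
    rw [Int.gcd_pos_iff]
    by_contra! h
    have hd0 : d = 0 := by
      rcases mul_eq_zero.1 h.2 with h1 | h1
      · omega
      · exact h1
    rw [h.1, hd0] at hcop
    exact not_isCoprime_zero_zero hcop
  obtain ⟨c', d', hcop', hc', hd'⟩ := Int.exists_gcd_one hpos
  set h := Int.gcd c (t * d) with hh
  obtain ⟨γ', -, hγ'⟩ := ModularGroup.bottom_row_surj (R := ℤ)
    (show ![c', d'] ∈ {cd : Fin 2 → ℤ | IsCoprime (cd 0) (cd 1)} from
      Int.isCoprime_iff_gcd_eq_one.2 hcop')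
  have h10 : γ' 1 0 = c' := by simpa using congrFun hγ' 0
  have h11 : γ' 1 1 = d' := by simpa using congrFun hγ' 1
  have ht' : (0 : ℝ) < t := by exact_mod_cast ht
  have hh' : (1 : ℝ) ≤ h := by exact_mod_cast hpos
  refine ⟨γ', ?_⟩
  rw [ModularGroup.im_smul_eq_div_normSq, ModularGroup.im_smul_eq_div_normSq,
    ModularGroup.denom_apply, ModularGroup.denom_apply, h10, h11, ← hc, ← hd]
  have hden : (c' : ℂ) * w + d' = ((t / h : ℝ) : ℂ) * (c * z + d) := by
    have e1 : (c : ℂ) = c' * h := by exact_mod_cast hc'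
    have e2 : (t : ℂ) * d = d' * h := by exact_mod_cast hd'
    have hne : (h : ℂ) ≠ 0 := by exact_mod_cast hpos.ne'
    rw [hw]
    push_cast
    field_simp
    linear_combination -(t * z : ℂ) * e1 - e2
  have him : w.im = t * z.im := by
    rw [← UpperHalfPlane.coe_im, hw, ← Complex.ofReal_natCast, Complex.im_ofReal_mul]
    rfl
  have hN : 0 < Complex.normSq (c * z + d) := by
    have := UpperHalfPlane.normSq_denom_pos (γ : GL (Fin 2) ℝ) z.im_ne_zero
    rwa [ModularGroup.denom_apply] at this
  rw [hden, Complex.normSq_mul, Complex.normSq_ofReal, him]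
  have hz := z.im_pos
  rw [div_div, div_le_div_iff₀ (by positivity) (by positivity)]
  have h3 : (t / h : ℝ) ≤ t := div_le_self ht'.le hh'
  have h4 : (t / h : ℝ) * (t / h) ≤ t * t := mul_le_mul h3 h3 (by positivity) ht'.le
  calc z.im * (t / h * (t / h) * Complex.normSq (c * z + d))
      ≤ z.im * (t * t * Complex.normSq (c * z + d)) := by gcongr
    _ = t * z.im * (Complex.normSq (c * z + d) * t) := by ring

/-- The function `u ^ (1 / 4) * e ^ (-π u / 12)` decreases on `u ≥ 1` because `π / 12 > 1 / 4`. -/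
theorem rpow_mul_exp_antitone {u v : ℝ} (hv : 1 ≤ v) (huv : v ≤ u) :
    u ^ (1 / 4 : ℝ) * Real.exp (-(π / 12 * u)) ≤ v ^ (1 / 4 : ℝ) * Real.exp (-(π / 12 * v)) := by
  have hu : 0 < u := by linarith
  have hv0 : 0 < v := by linarith
  rw [Real.rpow_def_of_pos hu, Real.rpow_def_of_pos hv0, ← Real.exp_add, ← Real.exp_add]
  refine Real.exp_le_exp.2 ?_
  have h1 : Real.log u - Real.log v ≤ u / v - 1 := by
    rw [← Real.log_div hu.ne' hv0.ne']
    exact Real.log_le_sub_one_of_pos (by positivity)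
  have h2 : u / v - 1 ≤ u - v := by
    rw [← sub_nonneg]
    have : u - v - (u / v - 1) = (u - v) * (v - 1) / v := by field_simp
    rw [this]
    have : 0 ≤ u - v := by linarith
    have : 0 ≤ v - 1 := by linarith
    positivity
  have := Real.pi_gt_three
  nlinarith

/-- The eta quotient is controlled by the height `Y` of the point of the fundamental domain
equivalent to `z`. When `Y ≥ t`, the point `t z` can be moved to height at least `Y / t ≥ 1`, and
the growth `e ^ (π Y / 12)` of `1 / η(z)` is cancelled by the `t`-th power of
`e ^ (-π Y / (12 t))`. When `Y < t`, the uniform bound for `etaNorm` at `t z` suffices. -/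
theorem exists_etaNorm_quotient_le : ∃ D : ℝ, 1 ≤ D ∧ ∀ (t : ℕ), 0 < t → ∀ (z w : ℍ),
    (w : ℂ) = t * z → ∀ γ : SL(2, ℤ), γ • z ∈ 𝒟 →
      etaNorm w ^ t / etaNorm z ≤ 4 * (Real.exp (t / 200) *
        ((γ • z).im ^ (((t : ℝ) - 1) / 4) * (t : ℝ) ^ (-((t : ℝ) / 4))) + D ^ t) := by
  obtain ⟨B, hB1, hB⟩ := exists_etaNorm_le
  have hpi := Real.pi_pos
  refine ⟨B * Real.exp (π / 12), ?_, fun t ht z w hw γ hγ => ?_⟩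
  · exact one_le_mul_of_one_le_of_one_le hB1 (Real.one_le_exp (by positivity))
  have ht' : (0 : ℝ) < t := by exact_mod_cast ht
  set Y := (γ • z).im with hY
  have hY1 : 1 / 2 ≤ Y := by
    have := ModularGroup.three_le_four_mul_im_sq_of_mem_fd hγ
    have := (γ • z).im_pos
    rw [← hY] at *
    nlinarith
  have hY0 : 0 < Y := by linarith
  have hz := le_etaNorm_of_half_le_im (τ := γ • z) hY1
  rw [etaNorm_smul, ← hY] at hz
  have hden : 0 < Y ^ (1 / 4 : ℝ) * Real.exp (-(π / 12 * Y)) * (1 / 2) := by positivity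
  have hinv : (etaNorm z)⁻¹ ≤ 2 * (Y ^ (-(1 / 4) : ℝ) * Real.exp (π / 12 * Y)) := by
    refine (inv_anti₀ hden hz).trans_eq ?_
    rw [mul_inv, mul_inv, ← Real.rpow_neg hY0.le, ← Real.exp_neg, neg_neg]
    ring
  rw [div_eq_mul_inv]
  have hw0 := (etaNorm_pos w).le
  rcases le_or_gt (t : ℝ) Y with h | h
  · obtain ⟨γ', hγ'⟩ := exists_smul_im_ge ht hw γ
    rw [← hY] at hγ'
    have hv : 1 ≤ Y / t := by rwa [one_le_div ht']
    have h1 := etaNorm_le_of_one_le_im (hv.trans hγ')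
    rw [etaNorm_smul] at h1
    have h2 := h1.trans (mul_le_mul_of_nonneg_right (rpow_mul_exp_antitone hv hγ')
      (Real.exp_pos _).le)
    have h3 := pow_le_pow_left₀ hw0 h2 t
    have h4 : ((Y / t) ^ (1 / 4 : ℝ) * Real.exp (-(π / 12 * (Y / t))) * Real.exp (1 / 200)) ^ t
        = Y ^ ((t : ℝ) / 4) * (t : ℝ) ^ (-((t : ℝ) / 4)) * Real.exp (-(π / 12 * Y))
          * Real.exp (t / 200) := by
      have e1 : (1 / 4 : ℝ) * t = t / 4 := by ring
      have e2 : (t : ℝ) * -(π / 12 * (Y / t)) = -(π / 12 * Y) := by field_simp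
      have e3 : (t : ℝ) * (1 / 200) = t / 200 := by ring
      rw [mul_pow, mul_pow, ← Real.exp_nat_mul, ← Real.exp_nat_mul, ← Real.rpow_natCast,
        ← Real.rpow_mul (by positivity), e1, e2, e3, Real.div_rpow hY0.le ht'.le,
        Real.rpow_neg ht'.le, div_eq_mul_inv]
    calc etaNorm w ^ t * (etaNorm z)⁻¹
        ≤ (Y ^ ((t : ℝ) / 4) * (t : ℝ) ^ (-((t : ℝ) / 4)) * Real.exp (-(π / 12 * Y))
          * Real.exp (t / 200)) * (2 * (Y ^ (-(1 / 4) : ℝ) * Real.exp (π / 12 * Y))) := by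
          rw [← h4]
          exact mul_le_mul h3 hinv (inv_nonneg.2 (etaNorm_pos z).le) (by positivity)
      _ = 2 * (Real.exp (t / 200) * ((Y ^ ((t : ℝ) / 4) * Y ^ (-(1 / 4) : ℝ))
          * (t : ℝ) ^ (-((t : ℝ) / 4)))) * (Real.exp (-(π / 12 * Y)) * Real.exp (π / 12 * Y)) := by
          ring
      _ = 2 * (Real.exp (t / 200) * (Y ^ (((t : ℝ) - 1) / 4) * (t : ℝ) ^ (-((t : ℝ) / 4)))) := by
          rw [← Real.rpow_add hY0, ← Real.exp_add, neg_add_cancel, Real.exp_zero, mul_one]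
          congr 5
          ring
      _ ≤ _ := by
          have : 0 ≤ Real.exp (t / 200) * (Y ^ (((t : ℝ) - 1) / 4)
              * (t : ℝ) ^ (-((t : ℝ) / 4))) := by
            positivity
          have : 0 ≤ (B * Real.exp (π / 12)) ^ t := by positivity
          linarith
  · have h5 : Y ^ (-(1 / 4) : ℝ) ≤ 2 := by
      have h6 : Y ^ (-(1 / 4) : ℝ) ≤ (1 / 2 : ℝ) ^ (-(1 / 4) : ℝ) :=
        Real.rpow_le_rpow_of_nonpos (by norm_num) hY1 (by norm_num)
      have h7 : (1 / 2 : ℝ) ^ (-(1 / 4) : ℝ) ≤ (1 / 2 : ℝ) ^ (-1 : ℝ) :=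
        Real.rpow_le_rpow_of_exponent_ge (by norm_num) (by norm_num) (by norm_num)
      rw [Real.rpow_neg_one] at h7
      linarith
    calc etaNorm w ^ t * (etaNorm z)⁻¹
        ≤ B ^ t * (2 * (2 * Real.exp (π / 12 * t))) := by
          refine mul_le_mul (pow_le_pow_left₀ hw0 (hB w) t) (hinv.trans ?_)
            (inv_nonneg.2 (etaNorm_pos z).le) (by positivity)
          gcongr
      _ = 4 * (B * Real.exp (π / 12)) ^ t := by
          rw [mul_pow, ← Real.exp_nat_mul, mul_comm (t : ℝ)]
          ring
      _ ≤ _ := by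
          have : 0 ≤ Real.exp (t / 200) * (Y ^ (((t : ℝ) - 1) / 4)
              * (t : ℝ) ^ (-((t : ℝ) / 4))) := by
            positivity
          linarith

/-- The bound for the eta quotient itself. The factor on the left is the inverse of the size
`t ^ (-t / 2) * y ^ (-(t - 1) / 2)` of the peak at `z = i y`. -/
theorem exists_norm_coreQuot_le : ∃ D : ℝ, 1 ≤ D ∧ ∀ (t : ℕ), 0 < t → ∀ (z : ℍ) (γ : SL(2, ℤ)),
    γ • z ∈ 𝒟 →
      (t : ℝ) ^ ((t : ℝ) / 2) * z.im ^ (((t : ℝ) - 1) / 2) * ‖coreQuot t z‖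
        ≤ 4 * (Real.exp (t / 200) * ((γ • z).im * z.im) ^ (((t : ℝ) - 1) / 4)
          + D ^ t * ((t : ℝ) ^ ((t : ℝ) / 4) * z.im ^ (((t : ℝ) - 1) / 4))) := by
  obtain ⟨D, hD1, hD⟩ := exists_etaNorm_quotient_le
  refine ⟨D, hD1, fun t ht z γ hγ => ?_⟩
  have ht' : (0 : ℝ) < t := by exact_mod_cast ht
  have hy := z.im_pos
  have him : ((t : ℂ) * z).im = t * z.im := by
    rw [← Complex.ofReal_natCast, Complex.im_ofReal_mul]
    rfl
  set w : ℍ := ⟨t * z, by rw [him]; positivity⟩ with hw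
  have h := hD t ht z w rfl γ hγ
  have hwim : w.im = t * z.im := him
  have hnorm : ‖coreQuot t z‖ = (etaNorm w ^ t / etaNorm z)
      * ((t * z.im) ^ (-((t : ℝ) / 4)) * z.im ^ (1 / 4 : ℝ)) := by
    have e1 : ((t * z.im) ^ (1 / 4 : ℝ)) ^ t = (t * z.im) ^ ((t : ℝ) / 4) := by
      rw [← Real.rpow_natCast, ← Real.rpow_mul (by positivity)]
      congr 1
      ring
    have hp : 0 < (t * z.im) ^ ((t : ℝ) / 4) := by positivity
    have hp2 : 0 < z.im ^ (1 / 4 : ℝ) := by positivity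
    have hη : 0 < ‖η (z : ℂ)‖ := norm_pos_iff.2 (ModularForm.eta_ne_zero z.2)
    rw [coreQuot, norm_div, norm_pow, etaNorm, etaNorm, hwim, mul_pow, e1,
      Real.rpow_neg (by positivity)]
    change ‖η (t * z)‖ ^ t / ‖η z‖ = _ * ‖η (t * z)‖ ^ t / _ * _
    field_simp
  have hw1 : (t : ℝ) ^ ((t : ℝ) / 2) * z.im ^ (((t : ℝ) - 1) / 2)
      * ((t * z.im) ^ (-((t : ℝ) / 4)) * z.im ^ (1 / 4 : ℝ))
      = (t : ℝ) ^ ((t : ℝ) / 4) * z.im ^ (((t : ℝ) - 1) / 4) := by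
    rw [Real.mul_rpow ht'.le hy.le]
    calc _ = ((t : ℝ) ^ ((t : ℝ) / 2) * (t : ℝ) ^ (-((t : ℝ) / 4)))
          * (z.im ^ (((t : ℝ) - 1) / 2) * z.im ^ (-((t : ℝ) / 4)) * z.im ^ (1 / 4 : ℝ)) := by ring
      _ = _ := by
        rw [← Real.rpow_add ht', ← Real.rpow_add hy, ← Real.rpow_add hy]
        congr 2 <;> ring
  have hYpos := (γ • z).im_pos
  calc _ = (etaNorm w ^ t / etaNorm z)
        * ((t : ℝ) ^ ((t : ℝ) / 4) * z.im ^ (((t : ℝ) - 1) / 4)) := by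
        rw [hnorm, ← hw1]
        ring
    _ ≤ _ := mul_le_mul_of_nonneg_right h (by positivity)
    _ = _ := by
        have e2 : (t : ℝ) ^ (-((t : ℝ) / 4)) * (t : ℝ) ^ ((t : ℝ) / 4) = 1 := by
          rw [← Real.rpow_add ht', neg_add_cancel, Real.rpow_zero]
        rw [Real.mul_rpow hYpos.le hy.le]
        linear_combination 4 * Real.exp (t / 200) * (γ • z).im ^ (((t : ℝ) - 1) / 4)
          * z.im ^ (((t : ℝ) - 1) / 4) * e2

/-! ### Elementary growth estimates -/

theorem sq_le_mul_exp {κ : ℝ} (hκ : 0 < κ) {t : ℝ} (ht : 0 ≤ t) :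
    t ^ 2 ≤ 2 / κ ^ 2 * Real.exp (κ * t) := by
  have h := Real.pow_div_factorial_le_exp (κ * t) (by positivity) 2
  rw [div_mul_eq_mul_div, le_div_iff₀ (by positivity)]
  rw [mul_pow] at h
  norm_num at h
  linarith

theorem rpow_le_sq {t p : ℝ} (ht : 1 ≤ t) (hp : p ≤ 2) : t ^ p ≤ t ^ 2 := by
  rw [← Real.rpow_natCast t 2]
  exact Real.rpow_le_rpow_of_exponent_le ht (by simpa using hp)

/-- Since `log 2 / 4 > 1 / 6 + 1 / 200`, the factor `2 ^ (-t / 4)` beats `e ^ (-t / 6)` with room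
for any power of `t`. -/
theorem exists_two_rpow_mul_exp_le : ∃ C : ℝ, 0 < C ∧ ∀ t : ℝ, 1 ≤ t →
    Real.exp (t / 200) * (1 / 2 : ℝ) ^ ((t - 6) / 4)
      ≤ C * (t ^ (-(1 / 2) : ℝ) * Real.exp (-(t / 6))) := by
  set κ : ℝ := Real.log 2 / 4 - 1 / 6 - 1 / 200 with hκ
  have hκ0 : 0 < κ := by
    have := Real.log_two_gt_d9
    rw [hκ]
    linarith
  refine ⟨Real.exp (6 * Real.log 2 / 4) * (2 / κ ^ 2), by positivity, fun t ht => ?_⟩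
  have h0 : 0 < t := by linarith
  have h1 : Real.exp (t / 200) * (1 / 2 : ℝ) ^ ((t - 6) / 4)
      = Real.exp (6 * Real.log 2 / 4) * Real.exp (-(κ * t)) * Real.exp (-(t / 6)) := by
    rw [Real.rpow_def_of_pos (by norm_num), ← Real.exp_add, ← Real.exp_add, ← Real.exp_add, one_div,
      Real.log_inv, hκ]
    congr 1
    ring
  rw [h1, ← mul_assoc]
  refine mul_le_mul_of_nonneg_right ?_ (Real.exp_pos _).le
  rw [mul_assoc]
  refine mul_le_mul_of_nonneg_left ?_ (Real.exp_pos _).le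
  rw [Real.exp_neg, Real.rpow_neg h0.le, ← div_eq_mul_inv, le_div_iff₀ (by positivity),
    inv_mul_le_iff₀ (Real.exp_pos _), mul_comm]
  exact (rpow_le_sq ht (by norm_num)).trans (sq_le_mul_exp hκ0 h0.le)

/-- If `u ≤ π / log t`, then `u ^ ((t - 5) / 4)` is smaller than every exponential in `t`. -/
theorem exists_pow_mul_rpow_le (D : ℝ) (hD : 1 ≤ D) : ∃ C : ℝ, 0 < C ∧ ∀ t u : ℝ, 6 ≤ t → 0 < u →
    u * Real.log t ≤ π →
      D ^ t * (u ^ ((t - 5) / 4) * t ^ (5 / 4 : ℝ))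
        ≤ C * (t ^ (-(1 / 2) : ℝ) * Real.exp (-(t / 6))) := by
  have hD0 : 0 < D := by linarith
  have hpi := Real.pi_gt_three
  -- `A ^ (-t)` beats `D ^ t` by `e ^ (-2 t)`; for `t ≥ T` one has `u ≤ A ^ (-4)`, and the bounded
  -- range `t < T` is absorbed by the constant
  set A : ℝ := D * Real.exp 2 with hA
  have hA0 : 0 < A := by positivity
  set T : ℝ := Real.exp (π * A ^ 4) with hT
  refine ⟨2 * A ^ 5 + D ^ T * (π ^ T * T ^ 2 * Real.exp T), by positivity,
    fun t u ht hu hut => ?_⟩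
  have ht0 : 0 < t := by linarith
  have hsplit : ∀ X, D ^ t * (u ^ ((t - 5) / 4) * t ^ 2) * Real.exp (t / 6) ≤ X →
      D ^ t * (u ^ ((t - 5) / 4) * t ^ (5 / 4 : ℝ))
        ≤ X * (t ^ (-(1 / 2) : ℝ) * Real.exp (-(t / 6))) := by
    intro X hX
    have h1 : t ^ (5 / 4 : ℝ) * t ^ (1 / 2 : ℝ) ≤ t ^ 2 := by
      rw [← Real.rpow_add ht0]
      exact rpow_le_sq (by linarith) (by norm_num)
    have h2 : D ^ t * (u ^ ((t - 5) / 4) * (t ^ (5 / 4 : ℝ) * t ^ (1 / 2 : ℝ))) * Real.exp (t / 6)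
        ≤ X := by
      refine le_trans ?_ hX
      gcongr
    rw [Real.rpow_neg ht0.le, Real.exp_neg, ← mul_inv, ← div_eq_mul_inv,
        le_div_iff₀ (by positivity)]
    refine le_trans (le_of_eq ?_) h2
    ring
  refine hsplit _ ?_
  have hlog1 : 1 ≤ Real.log t := by
    rw [Real.le_log_iff_exp_le ht0]
    have := Real.exp_one_lt_d9
    linarith
  rcases le_or_gt T t with h | h
  · have hlogT : π * A ^ 4 ≤ Real.log t := by
      rw [Real.le_log_iff_exp_le ht0]
      exact h
    have hu1 : u ≤ (A ^ 4)⁻¹ := by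
      rw [← one_div, le_div_iff₀ (by positivity)]
      have h1 : u * (π * A ^ 4) ≤ π * 1 := by
        rw [mul_one]
        exact (mul_le_mul_of_nonneg_left hlogT hu.le).trans hut
      have h2 : π * (u * A ^ 4) ≤ π * 1 := by linarith
      exact le_of_mul_le_mul_left h2 (by linarith)
    have hu2 : u ^ ((t - 5) / 4) ≤ A ^ (5 - t) := by
      refine (Real.rpow_le_rpow hu.le hu1 (by linarith)).trans_eq ?_
      rw [← Real.rpow_natCast, ← Real.rpow_neg hA0.le, ← Real.rpow_mul hA0.le]
      congr 1
      push_cast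
      ring
    have hA5 : D ^ t * A ^ (5 - t) = A ^ 5 * Real.exp (-(2 * t)) := by
      rw [Real.rpow_sub hA0, hA, Real.mul_rpow hD0.le (Real.exp_pos _).le (z := t), ← Real.exp_mul,
        Real.exp_neg, ← Real.rpow_natCast]
      have : D ^ t ≠ 0 := by positivity
      push_cast
      field_simp
    have h3 := sq_le_mul_exp one_pos ht0.le
    norm_num at h3
    calc D ^ t * (u ^ ((t - 5) / 4) * t ^ 2) * Real.exp (t / 6)
        ≤ D ^ t * (A ^ (5 - t) * (2 * Real.exp t)) * Real.exp (t / 6) := by gcongr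
      _ = A ^ 5 * (2 * (Real.exp t * Real.exp (t / 6) * Real.exp (-(2 * t)))) := by
          linear_combination 2 * Real.exp t * Real.exp (t / 6) * hA5
      _ ≤ A ^ 5 * (2 * 1) := by
          gcongr
          rw [← Real.exp_add, ← Real.exp_add, Real.exp_le_one_iff]
          linarith
      _ ≤ _ := by
          have : 0 ≤ D ^ T * (π ^ T * T ^ 2 * Real.exp T) := by positivity
          linarith
  · have hupi : u ≤ π := by nlinarith
    have h1 : u ^ ((t - 5) / 4) ≤ π ^ T := by
      refine (Real.rpow_le_rpow hu.le hupi (by linarith)).trans ?_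
      exact Real.rpow_le_rpow_of_exponent_le (by linarith) (by linarith)
    have h2 : D ^ t ≤ D ^ T := Real.rpow_le_rpow_of_exponent_le hD h.le
    calc D ^ t * (u ^ ((t - 5) / 4) * t ^ 2) * Real.exp (t / 6)
        ≤ D ^ T * (π ^ T * T ^ 2) * Real.exp T := by
          gcongr
          linarith
      _ ≤ _ := by
          have : 0 ≤ 2 * A ^ 5 := by positivity
          linarith

/-! ### The minor arcs -/

theorem integrable_inv_one_add_div_sq {y : ℝ} (hy : 0 < y) (b : ℝ) :
    Integrable fun x : ℝ => (1 + ((x + b) / y) ^ 2)⁻¹ :=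
  (integrable_inv_one_add_sq.comp_div hy.ne').comp_add_right b

theorem integral_inv_one_add_div_sq {y : ℝ} (hy : 0 < y) (b : ℝ) :
    ∫ x : ℝ, (1 + ((x + b) / y) ^ 2)⁻¹ = π * y := by
  rw [integral_add_right_eq_self (fun x : ℝ => (1 + (x / y) ^ 2)⁻¹) b,
    Measure.integral_comp_div (fun x : ℝ => (1 + x ^ 2)⁻¹) y, integral_univ_inv_one_add_sq,
    abs_of_pos hy, smul_eq_mul, mul_comm]

/-- A truncated Eisenstein series in `x + i y`, a majorant for `(Y y) ^ (5 / 4)`, where `Y` is the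
height of `x + i y` modulo `SL(2, ℤ)`. The pair `(n, e)` is the bottom row of a matrix. The exponent
`5 / 4` is large enough for the sum of the `n ^ (-5 / 2)` over all rows to converge. -/
noncomputable def heightSum (y x : ℝ) : ℝ :=
  ∑ n ∈ Finset.Icc 1 ⌈2 / y⌉₊, ∑ e ∈ Finset.Icc (-(n : ℤ) - 1) 1,
    (n : ℝ) ^ (-(5 / 2) : ℝ) * (1 + ((x + e / n) / y) ^ 2)⁻¹

theorem heightSum_nonneg (y x : ℝ) : 0 ≤ heightSum y x :=
  Finset.sum_nonneg fun n _ => Finset.sum_nonneg fun e _ => by positivity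

theorem integrable_heightSum {y : ℝ} (hy : 0 < y) : Integrable (heightSum y) :=
  integrable_finsetSum _ fun _ _ => integrable_finsetSum _ fun _ _ =>
    (integrable_inv_one_add_div_sq hy _).const_mul _

theorem exists_integral_heightSum_le : ∃ C : ℝ, 0 < C ∧ ∀ y : ℝ, 0 < y →
    ∫ x, heightSum y x ≤ C * y := by
  have hs : Summable fun n : ℕ => (n : ℝ) ^ (-(3 / 2) : ℝ) :=
    Real.summable_nat_rpow.2 (by norm_num)
  set Z := ∑' n : ℕ, (n : ℝ) ^ (-(3 / 2) : ℝ) with hZ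
  have hZ0 : 0 ≤ Z := tsum_nonneg fun n => by positivity
  have hpi := Real.pi_pos
  refine ⟨4 * π * (Z + 1), by positivity, fun y hy => ?_⟩
  have h1 : ∫ x, heightSum y x = ∑ n ∈ Finset.Icc 1 ⌈2 / y⌉₊, ∑ e ∈ Finset.Icc (-(n : ℤ) - 1) 1,
      (n : ℝ) ^ (-(5 / 2) : ℝ) * (π * y) := by
    simp only [heightSum]
    rw [integral_finsetSum _ fun _ _ => integrable_finsetSum _ fun _ _ =>
      (integrable_inv_one_add_div_sq hy _).const_mul _]
    refine Finset.sum_congr rfl fun n _ => ?_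
    rw [integral_finsetSum _ fun e _ => (integrable_inv_one_add_div_sq hy _).const_mul _]
    refine Finset.sum_congr rfl fun e _ => ?_
    rw [integral_const_mul, integral_inv_one_add_div_sq hy]
  have h2 : ∀ n ∈ Finset.Icc 1 ⌈2 / y⌉₊, ∑ e ∈ Finset.Icc (-(n : ℤ) - 1) 1,
      (n : ℝ) ^ (-(5 / 2) : ℝ) * (π * y) ≤ 4 * π * y * (n : ℝ) ^ (-(3 / 2) : ℝ) := by
    intro n hn
    have hn1 : (1 : ℝ) ≤ n := by exact_mod_cast (Finset.mem_Icc.1 hn).1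
    have hn0 : (0 : ℝ) < n := by linarith
    rw [Finset.sum_const, nsmul_eq_mul, Int.card_Icc]
    have h3 : ((1 + 1 - (-(n : ℤ) - 1)).toNat : ℝ) = n + 3 := by
      have : (1 + 1 - (-(n : ℤ) - 1)).toNat = n + 3 := by omega
      rw [this]
      push_cast
      ring
    have h4 : (n : ℝ) ^ (-(3 / 2) : ℝ) = n * (n : ℝ) ^ (-(5 / 2) : ℝ) := by
      rw [← Real.rpow_one_add' hn0.le (by norm_num)]
      norm_num
    rw [h3, h4]
    have h5 : (n : ℝ) + 3 ≤ 4 * n := by linarith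
    calc ((n : ℝ) + 3) * ((n : ℝ) ^ (-(5 / 2) : ℝ) * (π * y))
        ≤ (4 * n) * ((n : ℝ) ^ (-(5 / 2) : ℝ) * (π * y)) := by gcongr
      _ = _ := by ring
  calc ∫ x, heightSum y x ≤ ∑ n ∈ Finset.Icc 1 ⌈2 / y⌉₊, 4 * π * y * (n : ℝ) ^ (-(3 / 2) : ℝ) := by
        rw [h1]
        exact Finset.sum_le_sum h2
    _ = 4 * π * y * ∑ n ∈ Finset.Icc 1 ⌈2 / y⌉₊, (n : ℝ) ^ (-(3 / 2) : ℝ) := by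
        rw [Finset.mul_sum]
    _ ≤ 4 * π * y * (Z + 1) := by
        have := hs.sum_le_tsum (Finset.Icc 1 ⌈2 / y⌉₊) fun n _ => by positivity
        have : ∑ n ∈ Finset.Icc 1 ⌈2 / y⌉₊, (n : ℝ) ^ (-(3 / 2) : ℝ) ≤ Z + 1 := by linarith
        gcongr
    _ = _ := by ring

/-- On the minor arcs the height `Y` of `x + i y` modulo `SL(2, ℤ)` satisfies `Y y ≤ 1 / 2`, and
`(Y y) ^ (5 / 4)` is dominated by `heightSum`. -/
theorem height_mul_le {y x : ℝ} (hy : 0 < y) (hy2 : y ≤ 1 / 2) (hx : y ≤ x) (hx1 : x ≤ 1 - y)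
    {z : ℍ} (hz : (z : ℂ) = x + y * I) {γ : SL(2, ℤ)} (hγ : γ • z ∈ 𝒟) :
    (γ • z).im * z.im ≤ 1 / 2 ∧ ((γ • z).im * z.im) ^ (5 / 4 : ℝ) ≤ heightSum y x := by
  have hzim : z.im = y := by
    rw [← UpperHalfPlane.coe_im, hz]
    simp
  have hY1 : 1 / 2 < (γ • z).im := by
    have := ModularGroup.three_le_four_mul_im_sq_of_mem_fd hγ
    have := (γ • z).im_pos
    nlinarith
  have hYdef := ModularGroup.im_smul_eq_div_normSq γ z
  rw [ModularGroup.denom_apply] at hYdef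
  set Y := (γ • z).im with hY
  set c := γ 1 0 with hc
  set d := γ 1 1 with hd
  have hN : Complex.normSq (c * z + d) = (c * x + d) ^ 2 + c ^ 2 * y ^ 2 := by
    rw [hz, Complex.normSq_apply]
    simp
    ring
  rw [hN, hzim] at hYdef
  have hcop : IsCoprime c d := ModularGroup.bottom_row_coprime γ
  -- if `c = 0`, the height is `y ≤ 1 / 2`, below the fundamental domain
  have hc0 : c ≠ 0 := by
    intro h0
    rw [h0, isCoprime_zero_left, Int.isUnit_iff] at hcop
    have hd2 : (d : ℝ) ^ 2 = 1 := by rcases hcop with h | h <;> rw [h] <;> norm_num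
    rw [h0] at hYdef
    simp [hd2] at hYdef
    linarith
  -- normalise the bottom row so that its first entry is positive
  obtain ⟨n, e, hn1, hne⟩ : ∃ (n : ℕ) (e : ℤ), 1 ≤ n ∧
      (c * x + d) ^ 2 + c ^ 2 * y ^ 2 = (n * x + e) ^ 2 + (n : ℝ) ^ 2 * y ^ 2 := by
    rcases lt_or_gt_of_ne hc0 with h | h
    · refine ⟨c.natAbs, -d, by omega, ?_⟩
      have : ((c.natAbs : ℕ) : ℝ) = -c := by
        rw [Nat.cast_natAbs, abs_of_neg h, Int.cast_neg]
      rw [this]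
      push_cast
      ring
    · refine ⟨c.natAbs, d, by omega, ?_⟩
      have : ((c.natAbs : ℕ) : ℝ) = c := by
        rw [Nat.cast_natAbs, abs_of_pos h]
      rw [this]
  rw [hne] at hYdef
  have hn1' : (1 : ℝ) ≤ n := by exact_mod_cast hn1
  have hn0 : (0 : ℝ) < n := by linarith
  set S := (n * x + e) ^ 2 + (n : ℝ) ^ 2 * y ^ 2 with hS
  have hny : 0 < (n : ℝ) ^ 2 * y ^ 2 := by positivity
  have hS0 : 0 < S := by positivity
  have hYS : Y * S = y := by rw [hYdef]; field_simp
  have hV : Y * z.im = y ^ 2 / S := by rw [hzim, hYdef]; field_simp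
  have hS2 : S ≤ 2 * y := by
    have := mul_le_mul_of_nonneg_right hY1.le hS0.le
    linarith
  rw [hV]
  constructor
  · rw [div_le_iff₀ hS0]
    rcases hn1.eq_or_lt with h | h
    -- for `n = 1` the distance from `x` to the integer `-e` is at least `y`
    · have hsq : y ^ 2 ≤ (x + e) ^ 2 := by
        rcases le_or_gt 0 e with he | he
        · have : (0 : ℝ) ≤ e := by exact_mod_cast he
          nlinarith
        · have : (e : ℝ) ≤ -1 := by exact_mod_cast (by omega : e ≤ -1)
          nlinarith
      rw [hS, ← h]
      push_cast
      nlinarith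
    · have h2 : (2 : ℝ) ≤ n := by exact_mod_cast h
      have h4 : 4 * y ^ 2 ≤ (n : ℝ) ^ 2 * y ^ 2 := by
        gcongr
        nlinarith
      nlinarith [sq_nonneg (n * x + e)]
  · have hVeq : y ^ 2 / S = ((n : ℝ) ^ 2)⁻¹ * (1 + ((x + e / n) / y) ^ 2)⁻¹ := by
      rw [← mul_inv, div_eq_iff hS0.ne', hS]
      field_simp
      ring
    have hW1 : (1 + ((x + e / n) / y) ^ 2)⁻¹ ≤ 1 :=
      inv_le_one_of_one_le₀ (le_add_of_nonneg_right (sq_nonneg _))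
    have hW0 : 0 < (1 + ((x + e / n) / y) ^ 2)⁻¹ := by positivity
    have hle : (y ^ 2 / S) ^ (5 / 4 : ℝ)
        ≤ (n : ℝ) ^ (-(5 / 2) : ℝ) * (1 + ((x + e / n) / y) ^ 2)⁻¹ := by
      rw [hVeq, Real.mul_rpow (by positivity) hW0.le]
      refine mul_le_mul (le_of_eq ?_) ?_ (by positivity) (by positivity)
      · rw [← Real.rpow_natCast, ← Real.rpow_neg hn0.le, ← Real.rpow_mul hn0.le]
        norm_num
      · exact Real.rpow_le_self_of_le_one hW0.le hW1 (by norm_num)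
    refine hle.trans ?_
    have hnK : n ∈ Finset.Icc 1 ⌈2 / y⌉₊ := by
      refine Finset.mem_Icc.2 ⟨hn1, ?_⟩
      have : (n : ℝ) ≤ 2 / y := by
        rw [le_div_iff₀ hy]
        have h1 : (n : ℝ) ^ 2 * y * y ≤ 2 * y := by
          have := sq_nonneg (n * x + e)
          linarith
        have h2 : (n : ℝ) ^ 2 * y ≤ 2 := le_of_mul_le_mul_right h1 hy
        exact (mul_le_mul_of_nonneg_right (le_self_pow₀ hn1' two_ne_zero) hy.le).trans h2
      exact_mod_cast this.trans (Nat.le_ceil _)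
    have heK : e ∈ Finset.Icc (-(n : ℤ) - 1) 1 := by
      have h1 : (n * x + e) ^ 2 ≤ 1 := by linarith
      have h2 := abs_le.1 ((sq_le_one_iff_abs_le_one _).1 h1)
      have h3 : 0 ≤ n * x := mul_nonneg hn0.le (by linarith)
      have h4 : n * x ≤ n := mul_le_of_le_one_right hn0.le (by linarith)
      rw [Finset.mem_Icc]
      constructor
      · have : (-(n : ℝ) - 1) ≤ e := by linarith
        exact_mod_cast this
      · have : (e : ℝ) ≤ 1 := by linarith
        exact_mod_cast this
    refine le_trans ?_ (Finset.single_le_sum (f := fun n : ℕ =>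
      ∑ e ∈ Finset.Icc (-(n : ℤ) - 1) 1, (n : ℝ) ^ (-(5 / 2) : ℝ) * (1 + ((x + e / n) / y) ^ 2)⁻¹)
      (fun n _ => Finset.sum_nonneg fun e _ => by positivity) hnK)
    exact Finset.single_le_sum (f := fun e : ℤ =>
      (n : ℝ) ^ (-(5 / 2) : ℝ) * (1 + ((x + e / n) / y) ^ 2)⁻¹) (fun e _ => by positivity) heK

theorem continuous_coreQuot {t : ℕ} (ht : 0 < t) {y : ℝ} (hy : 0 < y) :
    Continuous fun x : ℝ => coreQuot t (x + y * I) := by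
  have ht' : (0 : ℝ) < t := by exact_mod_cast ht
  refine continuous_iff_continuousAt.2 fun x => ?_
  have him : 0 < ((x : ℂ) + y * I).im := by simpa using hy
  have himt : 0 < ((t : ℂ) * (x + y * I)).im := by
    rw [← Complex.ofReal_natCast, Complex.im_ofReal_mul]
    positivity
  refine ContinuousAt.div (ContinuousAt.pow ?_ t) ?_ (ModularForm.eta_ne_zero him)
  · exact ContinuousAt.comp (g := η) (f := fun x : ℝ => (t : ℂ) * (x + y * I))
      (ModularForm.differentiableAt_eta_of_mem_upperHalfPlaneSet himt).continuousAt (by fun_prop)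
  · exact ContinuousAt.comp (g := η) (f := fun x : ℝ => (x + y * I : ℂ))
      (ModularForm.differentiableAt_eta_of_mem_upperHalfPlaneSet him).continuousAt (by fun_prop)

/-- The contribution of the minor arcs, normalised by `t ^ (t / 2)`. It is smaller by `e ^ (-t / 6)`
than the width `y * t ^ (-1 / 2)` of the peak times its height `y ^ (-(t - 1) / 2)`. -/
theorem exists_minor_arc_le : ∃ C : ℝ, 0 < C ∧ ∀ (t : ℕ) (y : ℝ), 6 ≤ t → 0 < y → y ≤ 1 / 2 →
    t * y * Real.log t ≤ π →
      ∫ x in y..1 - y, (t : ℝ) ^ ((t : ℝ) / 2) * ‖coreQuot t (x + y * I)‖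
        ≤ C * (y ^ (1 - ((t : ℝ) - 1) / 2)
            * ((t : ℝ) ^ (-(1 / 2) : ℝ) * Real.exp (-((t : ℝ) / 6)))) := by
  obtain ⟨D, hD1, hD⟩ := exists_norm_coreQuot_le
  obtain ⟨C₁, hC₁, h₁⟩ := exists_two_rpow_mul_exp_le
  obtain ⟨C₂, hC₂, h₂⟩ := exists_pow_mul_rpow_le D hD1
  obtain ⟨C₃, hC₃, h₃⟩ := exists_integral_heightSum_le
  refine ⟨4 * (C₁ * C₃ + C₂), by positivity, fun t y ht hy hy2 hty => ?_⟩
  have ht6 : (6 : ℝ) ≤ t := by exact_mod_cast ht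
  have ht0 : (0 : ℝ) < t := by linarith
  have htpos : 0 < t := by omega
  set s : ℝ := ((t : ℝ) - 1) / 2 with hs
  set a : ℝ := Real.exp (t / 200) * (1 / 2 : ℝ) ^ (((t : ℝ) - 6) / 4) with ha
  set b : ℝ := D ^ t * ((t : ℝ) ^ ((t : ℝ) / 4) * y ^ (((t : ℝ) - 1) / 4)) with hb
  have ha0 : 0 ≤ a := by positivity
  have hb0 : 0 ≤ b := by positivity
  have hpt : ∀ x ∈ Set.Icc y (1 - y), (t : ℝ) ^ ((t : ℝ) / 2) * ‖coreQuot t (x + y * I)‖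
      ≤ y ^ (-s) * (4 * (a * heightSum y x + b)) := by
    intro x hx
    set z : ℍ := ⟨x + y * I, by simpa using hy⟩ with hz
    have hzim : z.im = y := by
      rw [← UpperHalfPlane.coe_im, hz]
      simp
    obtain ⟨γ, hγ⟩ := ModularGroup.exists_smul_mem_fd z
    obtain ⟨g1, g2⟩ := height_mul_le hy hy2 hx.1 hx.2 (z := z) rfl hγ
    have h := hD t htpos z γ hγ
    set V := (γ • z).im * z.im with hV
    have hV0 : 0 < V := mul_pos (γ • z).im_pos z.im_pos
    -- the power `5 / 4` of `V` is kept for the integration, the rest gives the exponential saving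
    have hVle : V ^ (((t : ℝ) - 1) / 4) ≤ (1 / 2 : ℝ) ^ (((t : ℝ) - 6) / 4) * heightSum y x := by
      rw [show ((t : ℝ) - 1) / 4 = (t - 6) / 4 + 5 / 4 by ring, Real.rpow_add hV0]
      exact mul_le_mul (Real.rpow_le_rpow hV0.le g1 (by linarith)) g2 (by positivity)
          (by positivity)
    rw [hzim] at h
    change _ * ‖coreQuot t (x + y * I)‖ ≤ _ at h
    rw [Real.rpow_neg hy.le, ← div_eq_inv_mul, le_div_iff₀ (by positivity)]
    calc (t : ℝ) ^ ((t : ℝ) / 2) * ‖coreQuot t (x + y * I)‖ * y ^ s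
        = (t : ℝ) ^ ((t : ℝ) / 2) * y ^ s * ‖coreQuot t (x + y * I)‖ := by ring
      _ ≤ _ := h
      _ ≤ 4 * (Real.exp (t / 200) * ((1 / 2 : ℝ) ^ (((t : ℝ) - 6) / 4) * heightSum y x) + b) := by
          gcongr
      _ = _ := by rw [ha]; ring
  have hint := integrable_heightSum hy
  have hH : ∫ x in y..1 - y, heightSum y x ≤ C₃ * y := by
    rw [intervalIntegral.integral_of_le (by linarith)]
    exact (setIntegral_le_integral hint (Eventually.of_forall (heightSum_nonneg y))).trans (h₃ y hy)
  have hmono := intervalIntegral.integral_mono_on (μ := volume) (by linarith : y ≤ 1 - y)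
    ((continuous_const.mul (continuous_coreQuot htpos hy).norm).intervalIntegrable _ _)
    ((((hint.intervalIntegrable.const_mul a).add
      (intervalIntegrable_const (c := b))).const_mul 4).const_mul (y ^ (-s))) hpt
  refine hmono.trans ?_
  rw [intervalIntegral.integral_const_mul, intervalIntegral.integral_const_mul,
    intervalIntegral.integral_add (hint.intervalIntegrable.const_mul a) intervalIntegrable_const,
    intervalIntegral.integral_const_mul, intervalIntegral.integral_const, smul_eq_mul]
  set w : ℝ := (t : ℝ) ^ (-(1 / 2) : ℝ) * Real.exp (-((t : ℝ) / 6)) with hw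
  have hw0 : 0 ≤ w := by positivity
  have hA : a ≤ C₁ * w := h₁ t (by linarith)
  have hB : b ≤ C₂ * w * y := by
    have h4 := h₂ t (t * y) ht6 (by positivity) hty
    have h5 : b = D ^ (t : ℝ) * ((t * y) ^ (((t : ℝ) - 5) / 4) * (t : ℝ) ^ (5 / 4 : ℝ)) * y := by
      rw [hb, Real.rpow_natCast, Real.mul_rpow ht0.le hy.le,
        show (t : ℝ) / 4 = (t - 5) / 4 + 5 / 4 by ring, Real.rpow_add ht0,
        show ((t : ℝ) - 1) / 4 = (t - 5) / 4 + 1 by ring, Real.rpow_add_one hy.ne']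
      ring
    rw [h5]
    exact mul_le_mul_of_nonneg_right h4 hy.le
  have hy1 : y ^ (1 - s) = y ^ (-s) * y := by
    rw [show 1 - s = -s + 1 by ring, Real.rpow_add_one hy.ne']
  rw [hy1]
  have hp : 0 < y ^ (-s) := by positivity
  have h6 : a * ∫ x in y..1 - y, heightSum y x ≤ (C₁ * w) * (C₃ * y) :=
    mul_le_mul hA hH (intervalIntegral.integral_nonneg (by linarith) fun x _ =>
        heightSum_nonneg y x)
      (by positivity)
  have h7 : (1 - y - y) * b ≤ C₂ * w * y := by nlinarith
  calc y ^ (-s) * (4 * ((a * ∫ x in y..1 - y, heightSum y x) + (1 - y - y) * b))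
      ≤ y ^ (-s) * (4 * ((C₁ * w) * (C₃ * y) + C₂ * w * y)) := by gcongr
    _ = _ := by ring

/-! ### The main term as an integral over a line -/

theorem integrableOn_rpow_mul_exp_neg_mul {p b : ℝ} (hp : -1 < p) (hb : 0 < b) :
    IntegrableOn (fun v : ℝ => v ^ p * Real.exp (-(b * v))) (Set.Ioi 0) := by
  have h := integrableOn_rpow_mul_exp_neg_mul_rpow hp one_pos hb
  simpa [Real.rpow_one, neg_mul] using h

theorem aestronglyMeasurable_rpow_mul_cexp (p : ℝ) (z : ℂ) :
    AEStronglyMeasurable (fun v : ℝ => ((v ^ p : ℝ) : ℂ) * cexp (-(z * v)))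
      (volume.restrict (Set.Ioi 0)) := by
  have h1 : Measurable fun v : ℝ => ((v ^ p : ℝ) : ℂ) :=
    Complex.measurable_ofReal.comp (measurable_id.pow_const p)
  exact (h1.mul (by fun_prop : Continuous fun v : ℝ =>
      cexp (-(z * v))).measurable).aestronglyMeasurable

theorem norm_rpow_mul_cexp (p : ℝ) (z : ℂ) {v : ℝ} (hv : 0 < v) :
    ‖((v ^ p : ℝ) : ℂ) * cexp (-(z * v))‖ = v ^ p * Real.exp (-(z.re * v)) := by
  rw [norm_mul, Complex.norm_real, Real.norm_of_nonneg (by positivity), Complex.norm_exp]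
  simp

theorem integrableOn_rpow_mul_cexp {p : ℝ} (hp : -1 < p) {z : ℂ} (hz : 0 < z.re) :
    IntegrableOn (fun v : ℝ => ((v ^ p : ℝ) : ℂ) * cexp (-(z * v))) (Set.Ioi 0) := by
  refine (integrableOn_rpow_mul_exp_neg_mul hp hz).mono' (aestronglyMeasurable_rpow_mul_cexp p z) ?_
  filter_upwards [ae_restrict_mem measurableSet_Ioi] with v hv
  exact (norm_rpow_mul_cexp p z hv).le

/-- The Laplace transform of `v ^ (s - 1)`, continued from the positive reals to the right half
plane. -/
theorem integral_rpow_mul_cexp_neg_mul {s : ℝ} (hs : 0 < s) {z : ℂ} (hz : 0 < z.re) :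
    ∫ v in Set.Ioi (0 : ℝ), ((v ^ (s - 1) : ℝ) : ℂ) * cexp (-(z * v))
      = z ^ (-(s : ℂ)) * (Real.Gamma s : ℂ) := by
  set U : Set ℂ := {z | 0 < z.re} with hU
  have hUo : IsOpen U := isOpen_lt continuous_const Complex.continuous_re
  have hd : DifferentiableOn ℂ
      (fun z : ℂ => ∫ v in Set.Ioi (0 : ℝ), ((v ^ (s - 1) : ℝ) : ℂ) * cexp (-(z * v))) U := by
    intro z₀ hz₀
    have hz₀' : 0 < z₀.re := hz₀
    refine DifferentiableAt.differentiableWithinAt ?_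
    have hF' : ∀ (z : ℂ) (v : ℝ), 0 < v → ((v ^ (s - 1) : ℝ) : ℂ) * (cexp (-(z * v)) * (-v))
        = -(((v ^ s : ℝ) : ℂ) * cexp (-(z * v))) := by
      intro z v hv
      have : ((v ^ s : ℝ) : ℂ) = ((v ^ (s - 1) : ℝ) : ℂ) * v := by
        rw [← Complex.ofReal_mul, ← Real.rpow_add_one hv.ne', sub_add_cancel]
      rw [this]
      ring
    refine (hasDerivAt_integral_of_dominated_loc_of_deriv_le (𝕜 := ℂ)
      (μ := volume.restrict (Set.Ioi (0 : ℝ)))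
      (F := fun z v => ((v ^ (s - 1) : ℝ) : ℂ) * cexp (-(z * v)))
      (F' := fun z v => ((v ^ (s - 1) : ℝ) : ℂ) * (cexp (-(z * v)) * (-v)))
      (bound := fun v => v ^ s * Real.exp (-(z₀.re / 2 * v)))
      (s := {z : ℂ | z₀.re / 2 < z.re}) ?_ ?_ ?_ ?_ ?_ ?_ ?_).2.differentiableAt
    · exact (isOpen_lt continuous_const Complex.continuous_re).mem_nhds (half_lt_self hz₀')
    · exact Eventually.of_forall fun z => aestronglyMeasurable_rpow_mul_cexp _ z
    · exact integrableOn_rpow_mul_cexp (by linarith) hz₀'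
    · refine (aestronglyMeasurable_rpow_mul_cexp s z₀).neg.congr ?_
      filter_upwards [ae_restrict_mem measurableSet_Ioi] with v hv
      exact (hF' z₀ v hv).symm
    · filter_upwards [ae_restrict_mem measurableSet_Ioi] with v hv z hz
      have hv0 : 0 < v := hv
      rw [hF' z v hv, norm_neg, norm_rpow_mul_cexp s z hv]
      have hz' : z₀.re / 2 < z.re := hz
      gcongr
    · exact integrableOn_rpow_mul_exp_neg_mul (by linarith) (by linarith)
    · refine Eventually.of_forall fun v z _ => ?_
      refine HasDerivAt.const_mul _ (HasDerivAt.cexp ?_)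
      have h := ((hasDerivAt_id' z).mul_const (v : ℂ)).fun_neg
      rwa [one_mul] at h
  have hd2 : DifferentiableOn ℂ (fun z : ℂ => z ^ (-(s : ℂ)) * (Real.Gamma s : ℂ)) U := by
    intro z₀ hz₀
    refine ((DifferentiableAt.cpow_const (f := fun z : ℂ => z) differentiableAt_id ?_).mul_const
      _).differentiableWithinAt
    exact Or.inl hz₀
  have hpre : IsPreconnected U := (convex_halfSpace_re_gt 0).isPreconnected
  refine (hd.analyticOnNhd hUo).eqOn_of_preconnected_of_frequently_eq (hd2.analyticOnNhd hUo) hpre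
    (z₀ := 1) (by simp [hU]) ?_ hz
  -- the two sides agree on the positive real axis
  have htend : Tendsto (fun r : ℝ => (r : ℂ)) (𝓝[≠] 1) (𝓝[≠] 1) := by
    refine tendsto_nhdsWithin_iff.2 ⟨?_, ?_⟩
    · exact (Complex.continuous_ofReal.tendsto' 1 1 (by simp)).mono_left nhdsWithin_le_nhds
    · filter_upwards [self_mem_nhdsWithin] with r hr
      simpa using hr
  refine htend.frequently (Eventually.frequently ?_)
  filter_upwards [nhdsWithin_le_nhds (Ioi_mem_nhds (zero_lt_one' ℝ))] with r hr
  have hr0 : 0 < r := hr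
  have h := Real.integral_rpow_mul_exp_neg_mul_Ioi hs hr0
  have h2 := congrArg (fun x : ℝ => (x : ℂ)) h
  rw [← integral_complex_ofReal] at h2
  push_cast at h2 ⊢
  rw [h2, one_div, Real.inv_rpow hr0.le, ← Real.rpow_neg hr0.le, Complex.ofReal_cpow hr0.le]
  push_cast
  rfl

theorem neg_I_mul_mem_slitPlane {y : ℝ} (hy : 0 < y) (x : ℝ) :
    -I * (x + y * I) ∈ Complex.slitPlane := by
  left
  simpa using hy

theorem norm_sq_neg_I_mul (x y : ℝ) : ‖-I * (x + y * I)‖ ^ 2 = x ^ 2 + y ^ 2 := by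
  rw [← Complex.normSq_eq_norm_sq, Complex.normSq_apply]
  simp
  ring

theorem norm_neg_I_mul_cpow {s x y : ℝ} (hy : 0 < y) :
    ‖(-I * ((x : ℂ) + y * I)) ^ (-(s : ℂ))‖ = y ^ (-s) * (1 + (x / y) ^ 2) ^ (-(s / 2)) := by
  have h1 : ‖-I * ((x : ℂ) + y * I)‖ = y * (1 + (x / y) ^ 2) ^ (1 / 2 : ℝ) := by
    rw [← Real.sqrt_eq_rpow, ← Real.sqrt_sq (norm_nonneg (-I * ((x : ℂ) + y * I))),
      norm_sq_neg_I_mul,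
      show x ^ 2 + y ^ 2 = y ^ 2 * (1 + (x / y) ^ 2) by field_simp; ring,
      Real.sqrt_mul (by positivity), Real.sqrt_sq hy.le]
  rw [← Complex.ofReal_neg, Complex.norm_cpow_real, h1, Real.mul_rpow hy.le (by positivity),
    ← Real.rpow_mul (by positivity)]
  congr 2
  ring

theorem continuous_neg_I_mul_cpow {y : ℝ} (hy : 0 < y) (c : ℂ) :
    Continuous fun x : ℝ => (-I * (x + y * I)) ^ c :=
  (by fun_prop : Continuous fun x : ℝ => -I * ((x : ℂ) + y * I)).cpow continuous_const
    fun x => neg_I_mul_mem_slitPlane hy x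

theorem integrable_neg_I_mul_cpow {s y : ℝ} (hs : 2 ≤ s) (hy : 0 < y) :
    Integrable fun x : ℝ => (-I * (x + y * I)) ^ (-(s : ℂ)) := by
  have h := (integrable_inv_one_add_div_sq hy 0).const_mul (y ^ (-s))
  simp only [add_zero] at h
  refine h.mono' (continuous_neg_I_mul_cpow hy _).aestronglyMeasurable
    (Eventually.of_forall fun x => ?_)
  rw [norm_neg_I_mul_cpow hy, ← Real.rpow_neg_one (1 + (x / y) ^ 2)]
  refine mul_le_mul_of_nonneg_left ?_ (by positivity)
  exact Real.rpow_le_rpow_of_exponent_le (le_add_of_nonneg_right (sq_nonneg _)) (by linarith)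

/-- Fourier inversion for the Gamma density. -/
theorem integral_cpow_mul_cexp {s y M : ℝ} (hs : 2 ≤ s) (hy : 0 < y) (hM : 0 < M) :
    ∫ x : ℝ, (-I * (x + y * I)) ^ (-(s : ℂ)) * cexp (-(2 * π * I * M * (x + y * I)))
      = (((2 * π) ^ s * M ^ (s - 1) / Real.Gamma s : ℝ) : ℂ) := by
  have hpi := Real.pi_pos
  have hΓ : 0 < Real.Gamma s := Real.Gamma_pos_of_pos (by linarith)
  set f : ℝ → ℂ := Set.indicator (Set.Ioi 0)
    (fun v : ℝ => ((v ^ (s - 1) : ℝ) : ℂ) * cexp (-(((2 * π * y : ℝ) : ℂ) * v))) with hf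
  have hfi : Integrable f := by
    rw [hf, integrable_indicator_iff measurableSet_Ioi]
    refine integrableOn_rpow_mul_cexp (by linarith) ?_
    rw [Complex.ofReal_re]
    positivity
  have hfour : ∀ w : ℝ, 𝓕 f w
      = (((2 * π) ^ (-s) * Real.Gamma s : ℝ) : ℂ) * (-I * ((-w : ℝ) + y * I)) ^ (-(s : ℂ)) := by
    intro w
    rw [Real.fourier_eq']
    have h1 : ∀ v : ℝ, cexp (((-2 * π * inner ℝ v w : ℝ) : ℂ) * I) • f v
        = Set.indicator (Set.Ioi 0) (fun v : ℝ => ((v ^ (s - 1) : ℝ) : ℂ)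
          * cexp (-((((2 * π : ℝ) : ℂ) * (-I * ((-w : ℝ) + y * I))) * v))) v := by
      intro v
      by_cases hv : v ∈ Set.Ioi (0 : ℝ)
      · rw [hf, Set.indicator_of_mem hv, Set.indicator_of_mem hv, smul_eq_mul, mul_left_comm,
          ← Complex.exp_add]
        congr 2
        simp only [RCLike.inner_apply, conj_trivial]
        push_cast
        linear_combination (-2 * π * y * v : ℂ) * Complex.I_sq
      · rw [hf, Set.indicator_of_notMem hv, Set.indicator_of_notMem hv, smul_zero]
    simp_rw [h1]
    rw [integral_indicator measurableSet_Ioi, integral_rpow_mul_cexp_neg_mul (by linarith)]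
    · have hne := Complex.slitPlane_ne_zero (neg_I_mul_mem_slitPlane hy (-w))
      rw [Complex.cpow_def_of_ne_zero (mul_ne_zero (by simp [hpi.ne']) hne),
        Complex.log_ofReal_mul (by positivity) hne, add_mul, Complex.exp_add,
        ← Complex.cpow_def_of_ne_zero hne, Complex.ofReal_mul, Real.rpow_def_of_pos (by positivity)]
      push_cast
      ring
    · rw [Complex.re_ofReal_mul]
      have : (-I * ((-w : ℝ) + y * I)).re = y := by simp
      rw [this]
      positivity
  have hfourint : Integrable (𝓕 f) := by
    rw [show 𝓕 f = _ from funext hfour]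
    exact ((integrable_neg_I_mul_cpow hs hy).comp_neg).const_mul _
  have hcont : ContinuousAt f M := by
    have h1 : ContinuousAt (fun v : ℝ => ((v ^ (s - 1) : ℝ) : ℂ)
        * cexp (-(((2 * π * y : ℝ) : ℂ) * v))) M := by
      refine ContinuousAt.mul ?_ (by fun_prop)
      exact Complex.continuous_ofReal.continuousAt.comp
        (Real.continuousAt_rpow_const M _ (Or.inl hM.ne'))
    refine h1.congr ?_
    filter_upwards [Ioi_mem_nhds hM] with v hv
    rw [hf, Set.indicator_of_mem (show v ∈ Set.Ioi (0 : ℝ) from hv)]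
  have hinv := hfi.fourierInv_fourier_eq hfourint hcont
  rw [Real.fourierInv_eq', hf, Set.indicator_of_mem (show M ∈ Set.Ioi (0 : ℝ) from hM)] at hinv
  rw [← integral_neg_eq_self] at hinv
  have h2 : ∀ x : ℝ, cexp (((2 * π * inner ℝ (-x) M : ℝ) : ℂ) * I) • 𝓕 f (-x)
      = ((((2 * π) ^ (-s) * Real.Gamma s : ℝ) : ℂ) * cexp (-(((2 * π * y : ℝ) : ℂ) * M)))
        * ((-I * (x + y * I)) ^ (-(s : ℂ)) * cexp (-(2 * π * I * M * (x + y * I)))) := by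
    intro x
    rw [hfour, neg_neg, smul_eq_mul]
    have h3 : cexp (((2 * π * inner ℝ (-x) M : ℝ) : ℂ) * I)
        = cexp (-(((2 * π * y : ℝ) : ℂ) * M)) * cexp (-(2 * π * I * M * (x + y * I))) := by
      rw [← Complex.exp_add]
      congr 1
      simp only [RCLike.inner_apply, conj_trivial]
      push_cast
      linear_combination (2 * π * M * y : ℂ) * Complex.I_sq
    rw [h3]
    ring
  rw [show (fun x : ℝ => cexp (((2 * π * inner ℝ (-x) M : ℝ) : ℂ) * I) • 𝓕 f (-x)) = _ from
    funext h2, integral_const_mul] at hinv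
  have he := Complex.exp_ne_zero (-(((2 * π * y : ℝ) : ℂ) * M))
  have hc : (((2 * π) ^ (-s) * Real.Gamma s : ℝ) : ℂ) ≠ 0 :=
    Complex.ofReal_ne_zero.2 (by positivity)
  have h4 : (((2 * π) ^ (-s) * Real.Gamma s : ℝ) : ℂ)
      * ∫ x : ℝ, (-I * (x + y * I)) ^ (-(s : ℂ)) * cexp (-(2 * π * I * M * (x + y * I)))
      = ((M ^ (s - 1) : ℝ) : ℂ) := by
    refine mul_right_cancel₀ he ?_
    rw [← hinv]
    ring
  refine mul_left_cancel₀ hc ?_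
  rw [h4, ← Complex.ofReal_mul]
  congr 1
  rw [Real.rpow_neg (by positivity)]
  field_simp

/-! ### A lower bound for the main term -/

/-- Stirling's upper bound at half-integers, from the duplication formula and log-convexity. -/
theorem exists_Gamma_le : ∃ C : ℝ, 0 < C ∧ ∀ n : ℕ, 1 ≤ n →
    Real.Gamma (((n : ℝ) + 1) / 2) ≤ C * ((((n : ℝ) + 1) / 2) ^ (((n : ℝ) + 1) / 2 - 1)
      * ((n : ℝ) + 2) ^ (1 / 2 : ℝ) * Real.exp (-(((n : ℝ) + 1) / 2))) := by
  have hpi := Real.pi_pos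
  refine ⟨√(Real.exp 2 * √(2 * π)), by positivity, fun n hn => ?_⟩
  have hn1 : (1 : ℝ) ≤ n := by exact_mod_cast hn
  set s : ℝ := ((n : ℝ) + 1) / 2 with hs
  have hs1 : 1 ≤ s := by rw [hs]; linarith
  have hG := Real.Gamma_pos_of_pos (show 0 < s by linarith)
  have hG1 := Real.Gamma_pos_of_pos (show 0 < s + 1 / 2 by linarith)
  have hG2 := Real.Gamma_pos_of_pos (show 0 < s - 1 / 2 by linarith)
  have hconv : Real.Gamma s * √(s - 1 / 2) ≤ Real.Gamma (s + 1 / 2) := by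
    have h := Real.Gamma_mul_add_mul_le_rpow_Gamma_mul_rpow_Gamma
      (show 0 < s - 1 / 2 by linarith) (show 0 < s + 1 / 2 by linarith)
      (show (0 : ℝ) < 1 / 2 by norm_num) (show (0 : ℝ) < 1 / 2 by norm_num) (by norm_num)
    rw [show 1 / 2 * (s - 1 / 2) + 1 / 2 * (s + 1 / 2) = s by ring, ← Real.sqrt_eq_rpow,
      ← Real.sqrt_eq_rpow] at h
    have hrec : Real.Gamma (s + 1 / 2) = (s - 1 / 2) * Real.Gamma (s - 1 / 2) := by
      rw [← Real.Gamma_add_one (by linarith)]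
      congr 1
      ring
    calc Real.Gamma s * √(s - 1 / 2)
        ≤ (√(Real.Gamma (s - 1 / 2)) * √(Real.Gamma (s + 1 / 2))) * √(s - 1 / 2) := by gcongr
      _ = √((s - 1 / 2) * Real.Gamma (s - 1 / 2)) * √(Real.Gamma (s + 1 / 2)) := by
          rw [Real.sqrt_mul (by linarith)]
          ring
      _ = Real.Gamma (s + 1 / 2) := by rw [← hrec, Real.mul_self_sqrt hG1.le]
  have hdup := Real.Gamma_mul_Gamma_add_half s
  rw [show 2 * s = (n : ℝ) + 1 by rw [hs]; ring, Real.Gamma_nat_eq_factorial,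
    show 1 - ((n : ℝ) + 1) = -(n : ℝ) by ring, Real.rpow_neg (by norm_num),
        Real.rpow_natCast] at hdup
  have hstir : (n.factorial : ℝ) ≤ Real.exp 1 * √n * (n / Real.exp 1) ^ n := by
    obtain ⟨m, rfl⟩ := Nat.exists_eq_add_of_le' hn
    have h := Stirling.stirlingSeq'_antitone (Nat.zero_le m)
    simp only [Function.comp_apply, Nat.succ_eq_add_one, zero_add] at h
    rw [Stirling.stirlingSeq_one, Stirling.stirlingSeq, div_le_iff₀ (by positivity)] at h
    refine h.trans (le_of_eq ?_)
    rw [Real.sqrt_mul (by norm_num)]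
    field_simp
  have hsn : s - 1 / 2 = n / 2 := by rw [hs]; ring
  have hsq : Real.Gamma s ^ 2 ≤ Real.exp 1 * √(2 * π) * ((n : ℝ) / 2) ^ n * Real.exp (-n) := by
    have hq : 0 < √((n : ℝ) / 2) := Real.sqrt_pos.2 (by linarith)
    refine le_of_mul_le_mul_right ?_ hq
    calc Real.Gamma s ^ 2 * √((n : ℝ) / 2) = Real.Gamma s * (Real.Gamma s * √(s - 1 / 2)) := by
          rw [hsn]; ring
      _ ≤ Real.Gamma s * Real.Gamma (s + 1 / 2) := by gcongr
      _ ≤ (Real.exp 1 * √n * (n / Real.exp 1) ^ n) * (2 ^ n)⁻¹ * √π := by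
          rw [hdup]
          gcongr
      _ = Real.exp 1 * √(2 * π) * ((n : ℝ) / 2) ^ n * Real.exp (-n) * √((n : ℝ) / 2) := by
          have h5 : Real.exp (-(n : ℝ)) = (Real.exp 1 ^ n)⁻¹ := by
            rw [Real.exp_neg, ← Real.exp_nat_mul, mul_one]
          rw [h5, div_pow, div_pow, Real.sqrt_mul (by norm_num), Real.sqrt_div (by linarith)]
          field_simp
  refine le_of_sq_le_sq ?_ (by positivity)
  refine hsq.trans ?_
  have hs0 : 0 < s := by linarith
  have e1 : (s ^ (s - 1)) ^ 2 = s ^ (n - 1) := by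
    rw [← Real.rpow_natCast, ← Real.rpow_mul hs0.le, ← Real.rpow_natCast, Nat.cast_sub hn]
    congr 1
    rw [hs]
    push_cast
    ring
  have e2 : (((n : ℝ) + 2) ^ (1 / 2 : ℝ)) ^ 2 = n + 2 := by
    rw [← Real.sqrt_eq_rpow, Real.sq_sqrt (by linarith)]
  have e3 : Real.exp (-s) ^ 2 = Real.exp (-1) * Real.exp (-n) := by
    rw [← Real.exp_nat_mul, ← Real.exp_add]
    congr 1
    rw [hs]
    push_cast
    ring
  have e4 : Real.exp 2 * Real.exp (-1) = Real.exp 1 := by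
    rw [← Real.exp_add]
    norm_num
  rw [mul_pow, mul_pow, mul_pow, Real.sq_sqrt (by positivity), e1, e2, e3]
  have h6 : ((n : ℝ) / 2) ^ n ≤ s ^ (n - 1) * (n + 2) := by
    obtain ⟨m, rfl⟩ := Nat.exists_eq_add_of_le' hn
    rw [pow_succ, Nat.add_sub_cancel]
    have : ((m + 1 : ℕ) : ℝ) / 2 ≤ s := by linarith
    have : ((m + 1 : ℕ) : ℝ) / 2 ≤ ((m + 1 : ℕ) : ℝ) + 2 := by linarith
    gcongr
  calc Real.exp 1 * √(2 * π) * ((n : ℝ) / 2) ^ n * Real.exp (-n)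
      ≤ Real.exp 1 * √(2 * π) * (s ^ (n - 1) * (n + 2)) * Real.exp (-n) := by gcongr
    _ = _ := by rw [← e4]; ring

/-! ### The major arc -/

theorem norm_cexp_neg_one_div {k x y : ℝ} (hk : 0 < k) (hy : 0 < y) :
    ‖cexp (2 * π * I * (-1 / (k * (x + y * I))))‖
      = Real.exp (-(2 * π / (k * y) / (1 + (x / y) ^ 2))) := by
  rw [norm_cexp_two_pi_I_mul]
  congr 2
  have h1 : (-1 / ((k : ℂ) * (x + y * I))).im = y / (k * (x ^ 2 + y ^ 2)) := by
    rw [show (-1 / ((k : ℂ) * (x + y * I))) = ((-k⁻¹ : ℝ) : ℂ) * ((x : ℂ) + y * I)⁻¹ by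
      push_cast; rw [div_eq_mul_inv, mul_inv]; ring, Complex.im_ofReal_mul, Complex.inv_im,
      Complex.normSq_apply]
    simp
    field_simp
  rw [h1]
  field_simp
  ring

theorem norm_pow_sub_one_le {a : ℂ} {r : ℝ} (h : ‖a - 1‖ ≤ r) (t : ℕ) (htr : t * r ≤ 2) :
    ‖a ^ t - 1‖ ≤ Real.exp 2 * (t * r) := by
  have h1 := Finset.norm_prod_one_add_sub_one_le (Finset.range t) (fun _ => a - 1)
  simp only [add_sub_cancel, Finset.prod_const, Finset.card_range, Finset.sum_const,
    nsmul_eq_mul] at h1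
  have hr : 0 ≤ r := (norm_nonneg _).trans h
  have h2 : (t : ℝ) * ‖a - 1‖ ≤ t * r := by gcongr
  refine h1.trans ?_
  have h3 : Real.exp (t * ‖a - 1‖) ≤ Real.exp (t * r) := Real.exp_le_exp.2 h2
  have h4 : Real.exp (t * r) - 1 ≤ t * r * Real.exp (t * r) := by
    have h5 := Real.add_one_le_exp (-(t * r))
    have h6 : Real.exp (-(t * r)) * Real.exp (t * r) = 1 := by
      rw [← Real.exp_add, neg_add_cancel, Real.exp_zero]
    nlinarith [Real.exp_pos (t * r)]
  have h7 : Real.exp (t * r) ≤ Real.exp 2 := Real.exp_le_exp.2 htr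
  have h8 : 0 ≤ t * r := by positivity
  nlinarith

/-- On the major arc `|x| ≤ y` the correction factor differs from `1` by
`O(t |e ^ (-2 π i / (t z))|)`. The condition on `y` makes this quantity bounded. -/
theorem norm_cuspFactor_sub_one_le {t : ℕ} {x y : ℝ} (ht : 6 ≤ t) (hy : 0 < y)
    (hty : t * y * Real.log t ≤ π) (hx : (x / y) ^ 2 ≤ 1) :
    ‖cuspFactor t (x + y * I) - 1‖
      ≤ 4 * (Real.exp 2 + 1) * (t * Real.exp (-(2 * π / (t * y) / (1 + (x / y) ^ 2)))) := by
  have ht6 : (6 : ℝ) ≤ t := by exact_mod_cast ht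
  have ht0 : (0 : ℝ) < t := by linarith
  have hpi := Real.pi_pos
  set r := Real.exp (-(2 * π / (t * y) / (1 + (x / y) ^ 2))) with hr
  have hr0 : 0 < r := Real.exp_pos _
  have hrt : t * r ≤ 1 := by
    have h1 : Real.log t ≤ 2 * π / (t * y) / (1 + (x / y) ^ 2) := by
      rw [le_div_iff₀ (by positivity), le_div_iff₀ (by positivity)]
      have hlog : 0 ≤ Real.log t := Real.log_nonneg (by linarith)
      have h2 : 0 ≤ t * y * Real.log t := by positivity
      nlinarith
    have h2 : r ≤ (t : ℝ)⁻¹ := by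
      rw [hr, Real.exp_neg]
      refine inv_anti₀ ht0 ?_
      rwa [← Real.log_le_iff_le_exp ht0]
    calc t * r ≤ t * (t : ℝ)⁻¹ := by gcongr
      _ = 1 := mul_inv_cancel₀ ht0.ne'
  have hr6 : r ≤ 1 / 6 := by nlinarith
  have hQ : ‖cexp (2 * π * I * (-1 / (t * (x + y * I))))‖ = r := by
    have := norm_cexp_neg_one_div (x := x) ht0 hy
    rwa [Complex.ofReal_natCast] at this
  have hQt : cexp (2 * π * I * (-1 / (x + y * I)))
      = cexp (2 * π * I * (-1 / (t * (x + y * I)))) ^ t := by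
    rw [← Complex.exp_nat_mul]
    congr 1
    have : (t : ℂ) ≠ 0 := by exact_mod_cast (by omega : t ≠ 0)
    field_simp
  have hQtn : ‖cexp (2 * π * I * (-1 / (x + y * I)))‖ ≤ r := by
    rw [hQt, norm_pow, hQ]
    exact pow_le_of_le_one hr0.le (by linarith) (by omega)
  set A := qPochInf (cexp (2 * π * I * (-1 / (t * (x + y * I))))) with hA
  set B := qPochInf (cexp (2 * π * I * (-1 / (x + y * I)))) with hB
  have hA1 : ‖A - 1‖ ≤ 2 * r := by
    rw [← hQ]
    exact norm_qPochInf_sub_one_le_two_mul (by rw [hQ]; linarith)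
  have hB1 : ‖B - 1‖ ≤ 2 * r :=
    (norm_qPochInf_sub_one_le_two_mul (by linarith)).trans (by linarith)
  have hAt : ‖A ^ t - 1‖ ≤ Real.exp 2 * (t * (2 * r)) :=
    norm_pow_sub_one_le hA1 t (by linarith)
  have hB2 : 1 / 2 ≤ ‖B‖ := by
    have h3 := norm_sub_norm_le (1 : ℂ) B
    rw [norm_one, norm_sub_rev] at h3
    linarith
  have hB0 : B ≠ 0 := norm_pos_iff.1 (by linarith)
  have heq : cuspFactor t (x + y * I) - 1 = ((A ^ t - 1) - (B - 1)) / B := by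
    rw [cuspFactor, ← hA, ← hB]
    field_simp
    ring
  rw [heq, norm_div, div_le_iff₀ (by linarith)]
  have h4 := norm_sub_le (A ^ t - 1) (B - 1)
  have h5 : r ≤ t * r := by nlinarith
  have h6 : 0 ≤ 4 * (Real.exp 2 + 1) * (t * r) := by positivity
  nlinarith

/-- The size of the first correction term on the major arc, relative to the peak, where
`L = 2 π / (t y)` and `v = (x / y) ^ 2`. If `L ≤ t / 5` the power of `1 + v` still gives Gaussian
decay; if `L > t / 5` everything is below `e ^ (-t / 5)`. -/
theorem rpow_mul_exp_le {t L v : ℝ} (ht : 5 ≤ t) (hv : 0 ≤ v) (hv1 : v ≤ 1) :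
    (1 + v) ^ (-((t - 1) / 4)) * Real.exp (-(L / (1 + v)))
      ≤ Real.exp (1 - L) * Real.exp (-(t / 40 * v)) + Real.exp (-(t / 5)) := by
  have h0 : 0 < 1 + v := by linarith
  rw [Real.rpow_def_of_pos h0, ← Real.exp_add, ← Real.exp_add]
  have hlog : v / (1 + v) ≤ Real.log (1 + v) := by
    have := Real.one_sub_inv_le_log_of_pos h0
    refine le_trans (le_of_eq ?_) this
    field_simp
    ring
  set p := v / (1 + v) with hp
  have hp0 : v / 2 ≤ p := by
    rw [hp]
    exact div_le_div_of_nonneg_left hv h0 (by linarith)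
  have hp1 : p ≤ 1 := by rw [hp, div_le_one h0]; linarith
  have hL' : L / (1 + v) = L * (1 - p) := by rw [hp]; field_simp; ring
  rw [hL']
  have hmain : Real.log (1 + v) * -((t - 1) / 4) ≤ -(p * ((t - 1) / 4)) := by
    have := mul_le_mul_of_nonneg_right hlog (by linarith : 0 ≤ (t - 1) / 4)
    linarith
  rcases le_or_gt L (t / 5) with h | h
  · refine le_add_of_le_of_nonneg (Real.exp_le_exp.2 ?_) (Real.exp_pos _).le
    have h1 : L * p ≤ t / 5 * p := mul_le_mul_of_nonneg_right h (by linarith)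
    have h2 : t / 20 * (v / 2) ≤ t / 20 * p := mul_le_mul_of_nonneg_left hp0 (by linarith)
    linarith
  · refine le_add_of_nonneg_of_le (Real.exp_pos _).le (Real.exp_le_exp.2 ?_)
    have h1 : t / 5 * (1 - p) ≤ L * (1 - p) := mul_le_mul_of_nonneg_right h.le (by linarith)
    have h2 : 0 ≤ p * (t / 20 - 1 / 4) := mul_nonneg (by linarith) (by linarith)
    linarith

/-- On the major arc the eta quotient may be replaced by its leading part at the cusp zero. -/
theorem exists_major_arc_le : ∃ C : ℝ, 0 < C ∧ ∀ (t : ℕ) (y : ℝ), 6 ≤ t → 0 < y →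
    t * y * Real.log t ≤ π →
      ∫ x in (-y)..y, ‖coreQuot t (x + y * I) - (((t : ℝ) ^ (-((t : ℝ) / 2)) : ℝ) : ℂ)
          * (-I * (x + y * I)) ^ (-((((t : ℝ) - 1) / 2 : ℝ) : ℂ))‖
        ≤ C * ((t : ℝ) ^ (-((t : ℝ) / 2)) * (y ^ (1 - ((t : ℝ) - 1) / 2) * (t : ℝ) ^ (-(1 / 2) : ℝ)
          * (t * Real.exp (-(2 * π / (t * y))) + Real.exp (-((t : ℝ) / 6))))) := by
  have hpi := Real.pi_pos
  set C₀ : ℝ := 4 * (Real.exp 2 + 1) with hC₀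
  have hC₀0 : 0 < C₀ := by positivity
  refine ⟨C₀ * (Real.exp 1 * √(40 * π) + 3600), by positivity, fun t y ht hy hty => ?_⟩
  have ht6 : (6 : ℝ) ≤ t := by exact_mod_cast ht
  have ht0 : (0 : ℝ) < t := by linarith
  set s : ℝ := ((t : ℝ) - 1) / 2 with hs
  set τ : ℝ := (t : ℝ) ^ (-((t : ℝ) / 2)) with hτ
  have hτ0 : 0 < τ := by positivity
  set L : ℝ := 2 * π / (t * y) with hL
  have hL0 : 0 < L := by positivity
  set b : ℝ := t / 40 / y ^ 2 with hb
  have hb0 : 0 < b := by positivity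
  have hpt : ∀ x ∈ Set.Icc (-y) y, ‖coreQuot t (x + y * I) - (τ : ℂ)
      * (-I * (x + y * I)) ^ (-(s : ℂ))‖
      ≤ τ * y ^ (-s) * C₀ * t * (Real.exp (1 - L) * Real.exp (-b * x ^ 2)
          + Real.exp (-(t / 5))) := by
    intro x hx
    have hu : (x / y) ^ 2 ≤ 1 := by
      rw [sq_le_one_iff_abs_le_one, abs_div, abs_of_pos hy, div_le_one hy]
      exact abs_le.2 hx
    have him : 0 < ((x : ℂ) + y * I).im := by simpa using hy
    have h1 := norm_cuspFactor_sub_one_le ht hy hty hu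
    have h2 := rpow_mul_exp_le (t := t) (L := L) (v := (x / y) ^ 2) (by linarith)
      (sq_nonneg _) hu
    rw [coreQuot_eq_cuspFactor (by omega) him, ← mul_sub_one, norm_mul, norm_mul, ← hτ, ← hs,
      norm_neg_I_mul_cpow hy, Complex.norm_real, Real.norm_of_nonneg hτ0.le,
      show s / 2 = ((t : ℝ) - 1) / 4 by rw [hs]; ring]
    have h3 : t / 40 * (x / y) ^ 2 = b * x ^ 2 := by rw [hb]; field_simp
    rw [h3, ← neg_mul] at h2
    calc τ * (y ^ (-s) * (1 + (x / y) ^ 2) ^ (-(((t : ℝ) - 1) / 4)))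
          * ‖cuspFactor t (x + y * I) - 1‖
        ≤ τ * (y ^ (-s) * (1 + (x / y) ^ 2) ^ (-(((t : ℝ) - 1) / 4)))
          * (C₀ * (t * Real.exp (-(L / (1 + (x / y) ^ 2))))) := by gcongr
      _ = τ * y ^ (-s) * C₀ * t * ((1 + (x / y) ^ 2) ^ (-(((t : ℝ) - 1) / 4))
          * Real.exp (-(L / (1 + (x / y) ^ 2)))) := by ring
      _ ≤ _ := by gcongr
  have hgi : Integrable fun x : ℝ => Real.exp (-b * x ^ 2) := integrable_exp_neg_mul_sq hb0
  have hG : ∫ x in (-y)..y, Real.exp (-b * x ^ 2) ≤ y * (√(40 * π) * (t : ℝ) ^ (-(1 / 2) : ℝ)) := by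
    rw [intervalIntegral.integral_of_le (by linarith)]
    refine (setIntegral_le_integral hgi (Eventually.of_forall fun x => (Real.exp_pos _).le)).trans
      (le_of_eq ?_)
    rw [integral_gaussian, show π / b = y ^ 2 * (40 * π / t) by rw [hb]; field_simp,
      Real.sqrt_mul (by positivity), Real.sqrt_sq hy.le, Real.sqrt_div (by positivity),
      Real.rpow_neg ht0.le, ← Real.sqrt_eq_rpow, div_eq_mul_inv]
  have hcont : Continuous fun x : ℝ => ‖coreQuot t (x + y * I) - (τ : ℂ)
      * (-I * (x + y * I)) ^ (-(s : ℂ))‖ :=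
    ((continuous_coreQuot (by omega) hy).sub
      (continuous_const.mul (continuous_neg_I_mul_cpow hy _))).norm
  have hmono := intervalIntegral.integral_mono_on (μ := volume) (by linarith : -y ≤ y)
    (hcont.intervalIntegrable _ _)
    (((hgi.intervalIntegrable.const_mul (Real.exp (1 - L))).add
      (intervalIntegrable_const (c := Real.exp (-((t : ℝ) / 5))))).const_mul
        (τ * y ^ (-s) * C₀ * t)) hpt
  refine hmono.trans ?_
  rw [intervalIntegral.integral_const_mul,
    intervalIntegral.integral_add (hgi.intervalIntegrable.const_mul _) intervalIntegrable_const,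
    intervalIntegral.integral_const_mul, intervalIntegral.integral_const, smul_eq_mul]
  have h5 : t * Real.exp (-((t : ℝ) / 5))
      ≤ 1800 * ((t : ℝ) ^ (-(1 / 2) : ℝ) * Real.exp (-((t : ℝ) / 6))) := by
    have h6 := sq_le_mul_exp (show (0 : ℝ) < 1 / 30 by norm_num) ht0.le
    norm_num at h6
    have h7 : (t : ℝ) * (t : ℝ) ^ (1 / 2 : ℝ) ≤ 1800 * Real.exp (1 / 30 * t) := by
      refine le_trans ?_ h6
      rw [← Real.rpow_one_add' ht0.le (by norm_num)]
      exact rpow_le_sq (by linarith) (by norm_num)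
    have h8 : Real.exp (-((t : ℝ) / 6)) = Real.exp (1 / 30 * t) * Real.exp (-((t : ℝ) / 5)) := by
      rw [← Real.exp_add]
      congr 1
      ring
    rw [Real.rpow_neg ht0.le, h8]
    have h9 : 0 < (t : ℝ) ^ (1 / 2 : ℝ) := by positivity
    calc (t : ℝ) * Real.exp (-((t : ℝ) / 5))
        = (t * (t : ℝ) ^ (1 / 2 : ℝ)) * ((t : ℝ) ^ (1 / 2 : ℝ))⁻¹ * Real.exp (-((t : ℝ) / 5)) := by
          field_simp
      _ ≤ (1800 * Real.exp (1 / 30 * t)) * ((t : ℝ) ^ (1 / 2 : ℝ))⁻¹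
            * Real.exp (-((t : ℝ) / 5)) := by
          gcongr
      _ = _ := by ring
  have hy1 : y ^ (1 - s) = y ^ (-s) * y := by
    rw [show 1 - s = -s + 1 by ring, Real.rpow_add_one hy.ne']
  have hexp : Real.exp (1 - L) = Real.exp 1 * Real.exp (-L) := by
    rw [← Real.exp_add, sub_eq_add_neg]
  rw [hy1, hexp]
  set w : ℝ := (t : ℝ) ^ (-(1 / 2) : ℝ) with hw
  have hw0 : 0 < w := by positivity
  calc τ * y ^ (-s) * C₀ * t * (Real.exp 1 * Real.exp (-L) * (∫ x in (-y)..y, Real.exp (-b * x ^ 2))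
        + (y - -y) * Real.exp (-(t / 5)))
      ≤ τ * y ^ (-s) * C₀ * t * (Real.exp 1 * Real.exp (-L) * (y * (√(40 * π) * w))
        + (y - -y) * Real.exp (-(t / 5))) := by gcongr
    _ = τ * y ^ (-s) * C₀ * y * (Real.exp 1 * √(40 * π) * w * (t * Real.exp (-L))
        + 2 * (t * Real.exp (-(t / 5)))) := by ring
    _ ≤ τ * y ^ (-s) * C₀ * y * (Real.exp 1 * √(40 * π) * w * (t * Real.exp (-L))
        + 2 * (1800 * (w * Real.exp (-(t / 6))))) := by gcongr
    _ = τ * y ^ (-s) * C₀ * y * w * (Real.exp 1 * √(40 * π) * (t * Real.exp (-L))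
        + 3600 * Real.exp (-(t / 6))) := by ring
    _ ≤ τ * y ^ (-s) * C₀ * y * w * ((Real.exp 1 * √(40 * π) + 3600) * (t * Real.exp (-L))
        + (Real.exp 1 * √(40 * π) + 3600) * Real.exp (-(t / 6))) := by
        gcongr
        · exact le_add_of_nonneg_right (by norm_num)
        · exact le_add_of_nonneg_left (by positivity)
    _ = _ := by ring

/-- The part of the main term integral outside the major arc, where `(x / y) ^ 2 ≥ 1` saves a factor
`2 ^ (-t / 4)`. -/
theorem exists_tail_le : ∃ C : ℝ, 0 < C ∧ ∀ (t : ℕ) (y : ℝ), 6 ≤ t → 0 < y →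
    ∫ x in (Set.Ioc (-y) y)ᶜ, ‖(-I * ((x : ℂ) + y * I)) ^ (-((((t : ℝ) - 1) / 2 : ℝ) : ℂ))‖
      ≤ C * (y ^ (1 - ((t : ℝ) - 1) / 2)
          * ((t : ℝ) ^ (-(1 / 2) : ℝ) * Real.exp (-((t : ℝ) / 6)))) := by
  obtain ⟨C₁, hC₁, h₁⟩ := exists_two_rpow_mul_exp_le
  have hpi := Real.pi_pos
  refine ⟨C₁ * π, by positivity, fun t y ht hy => ?_⟩
  have ht6 : (6 : ℝ) ≤ t := by exact_mod_cast ht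
  set s : ℝ := ((t : ℝ) - 1) / 2 with hs
  set a : ℝ := (1 / 2 : ℝ) ^ (((t : ℝ) - 6) / 4) with ha
  have ha0 : 0 < a := by positivity
  have hmaj := ((integrable_inv_one_add_div_sq hy 0).const_mul (y ^ (-s) * a))
  simp only [add_zero] at hmaj
  have hpt : ∀ x ∈ (Set.Ioc (-y) y)ᶜ, ‖(-I * ((x : ℂ) + y * I)) ^ (-(s : ℂ))‖
      ≤ y ^ (-s) * a * (1 + (x / y) ^ 2)⁻¹ := by
    intro x hx
    have hu : 1 ≤ (x / y) ^ 2 := by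
      rw [one_le_sq_iff_one_le_abs, abs_div, abs_of_pos hy, one_le_div hy]
      by_contra! h
      have := abs_lt.1 h
      exact hx ⟨this.1, this.2.le⟩
    have hv : 2 ≤ 1 + (x / y) ^ 2 := by linarith
    have hv0 : 0 < 1 + (x / y) ^ 2 := by linarith
    rw [norm_neg_I_mul_cpow hy, mul_assoc]
    refine mul_le_mul_of_nonneg_left ?_ (by positivity)
    rw [show -(s / 2) = -((t - 5) / 4) + -1 by rw [hs]; ring, Real.rpow_add hv0,
      Real.rpow_neg_one]
    refine mul_le_mul_of_nonneg_right ?_ (by positivity)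
    calc (1 + (x / y) ^ 2) ^ (-(((t : ℝ) - 5) / 4)) ≤ (2 : ℝ) ^ (-(((t : ℝ) - 5) / 4)) :=
          Real.rpow_le_rpow_of_nonpos (by norm_num) hv (by linarith)
      _ ≤ (2 : ℝ) ^ (-(((t : ℝ) - 6) / 4)) :=
          Real.rpow_le_rpow_of_exponent_le (by norm_num) (by linarith)
      _ = a := by rw [ha, one_div, Real.inv_rpow (by norm_num), Real.rpow_neg (by norm_num)]
  have hint := (integrable_neg_I_mul_cpow (s := s) (by rw [hs]; linarith) hy).norm
  have h2 : ∫ x in (Set.Ioc (-y) y)ᶜ, ‖(-I * ((x : ℂ) + y * I)) ^ (-(s : ℂ))‖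
      ≤ y ^ (-s) * a * (π * y) := by
    refine (setIntegral_mono_on hint.integrableOn hmaj.integrableOn measurableSet_Ioc.compl
      hpt).trans ?_
    refine (setIntegral_le_integral hmaj (Eventually.of_forall fun x => ?_)).trans (le_of_eq ?_)
    · change 0 ≤ y ^ (-s) * a * (1 + (x / y) ^ 2)⁻¹
      positivity
    · have h := integral_inv_one_add_div_sq hy 0
      simp only [add_zero] at h
      rw [integral_const_mul, h]
  have hy1 : y ^ (1 - s) = y ^ (-s) * y := by
    rw [show 1 - s = -s + 1 by ring, Real.rpow_add_one hy.ne']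
  have h3 := h₁ t (by linarith)
  have h4 : a ≤ Real.exp (t / 200) * a :=
      le_mul_of_one_le_left ha0.le (Real.one_le_exp (by positivity))
  rw [hy1]
  calc _ ≤ y ^ (-s) * a * (π * y) := h2
    _ ≤ y ^ (-s) * (C₁ * ((t : ℝ) ^ (-(1 / 2) : ℝ) * Real.exp (-((t : ℝ) / 6)))) * (π * y) := by
        have := h4.trans h3
        gcongr
    _ = _ := by ring

/-! ### The asymptotic formula -/

theorem shiftedSize_pos {t : ℕ} (ht : 2 ≤ t) (N : ℕ) : 0 < shiftedSize t N := by
  have : (2 : ℝ) ≤ t := by exact_mod_cast ht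
  rw [shiftedSize]
  have : 0 < ((t : ℝ) ^ 2 - 1) / 24 := by nlinarith
  positivity

theorem two_pi_mul_shiftedSize_mul_saddleY {t : ℕ} (ht : 2 ≤ t) (N : ℕ) :
    2 * π * shiftedSize t N * saddleY t N = ((t : ℝ) - 1) / 2 := by
  have := (shiftedSize_pos ht N).ne'
  have := Real.pi_ne_zero
  rw [saddleY]
  field_simp
  ring

/-- The main term is the integral over the line `im z = y` of the leading part of the eta quotient
at the cusp zero, for every height `y`. -/
theorem tCoreMainTerm_eq_integral {t : ℕ} (ht : 6 ≤ t) (N : ℕ) {y : ℝ} (hy : 0 < y) :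
    (tCoreMainTerm t N : ℂ) = (((t : ℝ) ^ (-((t : ℝ) / 2)) : ℝ) : ℂ)
      * ∫ x : ℝ, (-I * (x + y * I)) ^ (-((((t : ℝ) - 1) / 2 : ℝ) : ℂ))
        * cexp (-(2 * π * I * shiftedSize t N * (x + y * I))) := by
  have ht6 : (6 : ℝ) ≤ t := by exact_mod_cast ht
  rw [integral_cpow_mul_cexp (by linarith) hy (shiftedSize_pos (by omega) N), ← Complex.ofReal_mul,
    tCoreMainTerm, Real.rpow_neg (by linarith),
    show ((t : ℝ) - 1) / 2 - 1 = ((t : ℝ) - 3) / 2 by ring]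
  congr 1
  have : 0 < Real.Gamma (((t : ℝ) - 1) / 2) := Real.Gamma_pos_of_pos (by linarith)
  have : 0 < (t : ℝ) ^ ((t : ℝ) / 2) := Real.rpow_pos_of_pos (by linarith) _
  field_simp

/-- Up to a constant, the main term is at least the value of the integrand at the saddle point times
the width `y * t ^ (-1 / 2)` of the peak. -/
theorem exists_le_tCoreMainTerm : ∃ C : ℝ, 0 < C ∧ ∀ t N : ℕ, 6 ≤ t →
    (t : ℝ) ^ (-((t : ℝ) / 2)) * (saddleY t N ^ (1 - ((t : ℝ) - 1) / 2) * (t : ℝ) ^ (-(1 / 2) : ℝ)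
      * Real.exp (((t : ℝ) - 1) / 2)) ≤ C * tCoreMainTerm t N := by
  obtain ⟨C, hC, h⟩ := exists_Gamma_le
  have hpi := Real.pi_pos
  refine ⟨C / (2 * π), by positivity, fun t N ht => ?_⟩
  have ht6 : (6 : ℝ) ≤ t := by exact_mod_cast ht
  have ht0 : (0 : ℝ) < t := by linarith
  have hM := shiftedSize_pos (t := t) (by omega) N
  have hMy := two_pi_mul_shiftedSize_mul_saddleY (t := t) (by omega) N
  have hy : 0 < saddleY t N := by
    rw [saddleY]
    have : 0 < (t : ℝ) - 1 := by linarith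
    positivity
  have hΓ := h (t - 2) (by omega)
  rw [Nat.cast_sub (by omega : 2 ≤ t)] at hΓ
  push_cast at hΓ
  rw [show (t : ℝ) - 2 + 1 = t - 1 by ring, sub_add_cancel] at hΓ
  set s : ℝ := ((t : ℝ) - 1) / 2 with hs
  set y := saddleY t N with hyd
  set M := shiftedSize t N with hMd
  have hs0 : 0 < s := by rw [hs]; linarith
  have hΓ0 : 0 < Real.Gamma s := Real.Gamma_pos_of_pos hs0
  have hτ : 0 < (t : ℝ) ^ ((t : ℝ) / 2) := by positivity
  have hMT : tCoreMainTerm t N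
      = (t : ℝ) ^ (-((t : ℝ) / 2)) * (2 * π * (s ^ (s - 1) * y ^ (1 - s)) / Real.Gamma s) := by
    have h1 : (2 * π) ^ s * M ^ (s - 1) = 2 * π * (s ^ (s - 1) * y ^ (1 - s)) := by
      have h2 : s ^ (s - 1) = (2 * π) ^ (s - 1) * M ^ (s - 1) * y ^ (s - 1) := by
        rw [← Real.mul_rpow (by positivity) hM.le, ← Real.mul_rpow (by positivity) hy.le, hMy]
      rw [h2, show 1 - s = -(s - 1) by ring, Real.rpow_neg hy.le]
      have : 0 < y ^ (s - 1) := by positivity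
      field_simp
      rw [Real.rpow_sub_one (by positivity)]
      field_simp
    rw [tCoreMainTerm, ← hs, ← hMd, show ((t : ℝ) - 3) / 2 = s - 1 by rw [hs]; ring, ← h1,
      Real.rpow_neg ht0.le]
    field_simp
  rw [hMT, show C / (2 * π) * ((t : ℝ) ^ (-((t : ℝ) / 2))
      * (2 * π * (s ^ (s - 1) * y ^ (1 - s)) / Real.Gamma s))
      = (t : ℝ) ^ (-((t : ℝ) / 2)) * (y ^ (1 - s) * (C * s ^ (s - 1) / Real.Gamma s)) by
    field_simp, mul_assoc (y ^ (1 - s))]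
  refine mul_le_mul_of_nonneg_left (mul_le_mul_of_nonneg_left ?_ (by positivity)) (by positivity)
  rw [le_div_iff₀ hΓ0]
  calc (t : ℝ) ^ (-(1 / 2) : ℝ) * Real.exp s * Real.Gamma s
      ≤ (t : ℝ) ^ (-(1 / 2) : ℝ) * Real.exp s
        * (C * (s ^ (s - 1) * (t : ℝ) ^ (1 / 2 : ℝ) * Real.exp (-s))) := by gcongr
    _ = C * s ^ (s - 1) := by
        have : 0 < (t : ℝ) ^ (1 / 2 : ℝ) := by positivity
        rw [Real.rpow_neg ht0.le, Real.exp_neg]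
        field_simp

theorem norm_cexp_shiftedSize (M x y : ℝ) :
    ‖cexp (-(2 * π * I * M * (x + y * I)))‖ = Real.exp (2 * π * M * y) := by
  rw [Complex.norm_exp]
  congr 1
  rw [show -(2 * π * I * M * ((x : ℂ) + y * I)) = ((2 * π * M : ℝ) : ℂ) * (y - x * I) by
    push_cast
    linear_combination (-2 * π * M * y : ℂ) * Complex.I_sq, Complex.re_ofReal_mul]
  simp

/-- The asymptotic formula. The error `t e ^ (-2 π / (t y))` comes from the major arc, the error
`e ^ (-t / 6)` from all arcs and from the tail of the main term. -/
theorem exists_abs_tCoreCount_sub_le : ∃ C : ℝ, 0 < C ∧ ∀ t N : ℕ, 6 ≤ t →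
    t * saddleY t N * Real.log t ≤ π →
      |(tCoreCount t N : ℝ) - tCoreMainTerm t N| ≤ C * tCoreMainTerm t N
        * (t * Real.exp (-(2 * π / (t * saddleY t N))) + Real.exp (-((t : ℝ) / 6))) := by
  obtain ⟨C₁, hC₁, h₁⟩ := exists_major_arc_le
  obtain ⟨C₂, hC₂, h₂⟩ := exists_tail_le
  obtain ⟨C₃, hC₃, h₃⟩ := exists_minor_arc_le
  obtain ⟨C₄, hC₄, h₄⟩ := exists_le_tCoreMainTerm
  refine ⟨C₄ * (C₁ + C₂ + C₃), by positivity, fun t N ht hty => ?_⟩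
  have hpi := Real.pi_pos
  have ht6 : (6 : ℝ) ≤ t := by exact_mod_cast ht
  have ht0 : (0 : ℝ) < t := by linarith
  have htpos : 0 < t := by omega
  have hM := shiftedSize_pos (t := t) (by omega) N
  have hMy := two_pi_mul_shiftedSize_mul_saddleY (t := t) (by omega) N
  have hMT := h₄ t N ht
  have hy : 0 < saddleY t N := by
    rw [saddleY]
    have : 0 < (t : ℝ) - 1 := by linarith
    positivity
  set y := saddleY t N with hyd
  have hy2 : y ≤ 1 / 2 := by
    have h5 : 1.2 ≤ Real.log t := by
      have h6 : Real.log (2 ^ 2) ≤ Real.log t := Real.log_le_log (by norm_num) (by linarith)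
      rw [Real.log_pow] at h6
      have := Real.log_two_gt_d9
      push_cast at h6
      linarith
    have h7 : 6 * y * 1.2 ≤ t * y * Real.log t := by gcongr
    have := Real.pi_lt_d2
    linarith
  set s : ℝ := ((t : ℝ) - 1) / 2 with hs
  set τ : ℝ := (t : ℝ) ^ (-((t : ℝ) / 2)) with hτ
  have hτ0 : 0 < τ := by positivity
  set M := shiftedSize t N with hMd
  set K : ℝ → ℂ := fun x => (-I * (x + y * I)) ^ (-(s : ℂ)) with hK
  set E : ℝ → ℂ := fun x => cexp (-(2 * π * I * M * (x + y * I))) with hE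
  set Q : ℝ → ℂ := fun x => coreQuot t (x + y * I) with hQ
  have hEn : ∀ x, ‖E x‖ = Real.exp s := fun x => by rw [hE, norm_cexp_shiftedSize, hMy]
  have hEc : Continuous E := by fun_prop
  have hKc : Continuous K := continuous_neg_I_mul_cpow hy _
  have hQc : Continuous Q := continuous_coreQuot htpos hy
  have hQE : Continuous fun x => Q x * E x := hQc.mul hEc
  have hKE : Continuous fun x => (τ : ℂ) * (K x * E x) := continuous_const.mul (hKc.mul hEc)
  have hKi : Integrable K := integrable_neg_I_mul_cpow (by rw [hs]; linarith) hy
  have hKEi : Integrable fun x => K x * E x :=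
    hKi.mul_bdd hEc.aestronglyMeasurable (Eventually.of_forall fun x => (hEn x).le)
  -- the difference of the two integrals, split into major arc, minor arcs and tail
  have hsplit : (tCoreCount t N : ℂ) - tCoreMainTerm t N
      = (∫ x in (-y)..y, (Q x - τ * K x) * E x) + (∫ x in y..1 - y, Q x * E x)
        - τ * ∫ x in (Set.Ioc (-y) y)ᶜ, K x * E x := by
    have e1 : (tCoreCount t N : ℂ) = (∫ x in (-y)..y, Q x * E x) + ∫ x in y..1 - y, Q x * E x := by
      have h := tCoreCount_eq_integral htpos N (-y) hy
      rw [show -y + 1 = 1 - y by ring] at h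
      rw [intervalIntegral.integral_add_adjacent_intervals
        (hQE.intervalIntegrable _ _) (hQE.intervalIntegrable _ _)]
      exact h
    have e2 : (tCoreMainTerm t N : ℂ) = τ * (∫ x in (-y)..y, K x * E x)
        + τ * ∫ x in (Set.Ioc (-y) y)ᶜ, K x * E x := by
      have h := tCoreMainTerm_eq_integral ht N hy
      rw [h, ← mul_add, intervalIntegral.integral_of_le (by linarith),
        integral_add_compl measurableSet_Ioc hKEi]
    have e3 : ∫ x in (-y)..y, (Q x - τ * K x) * E x
        = (∫ x in (-y)..y, Q x * E x) - τ * ∫ x in (-y)..y, K x * E x := by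
      rw [← intervalIntegral.integral_const_mul, ← intervalIntegral.integral_sub
        (hQE.intervalIntegrable _ _) (hKE.intervalIntegrable _ _)]
      congr 1
      funext x
      ring
    rw [e1, e2, e3]
    ring
  have b1 : ‖∫ x in (-y)..y, (Q x - τ * K x) * E x‖
      ≤ (∫ x in (-y)..y, ‖Q x - τ * K x‖) * Real.exp s := by
    refine (intervalIntegral.norm_integral_le_integral_norm (by linarith)).trans (le_of_eq ?_)
    rw [← intervalIntegral.integral_mul_const]
    simp only [norm_mul, hEn]
  have b2 : ‖∫ x in y..1 - y, Q x * E x‖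
      ≤ τ * (∫ x in y..1 - y, (t : ℝ) ^ ((t : ℝ) / 2) * ‖Q x‖) * Real.exp s := by
    refine (intervalIntegral.norm_integral_le_integral_norm (by linarith)).trans (le_of_eq ?_)
    rw [← intervalIntegral.integral_const_mul, ← intervalIntegral.integral_mul_const]
    congr 1
    funext x
    have : τ * (t : ℝ) ^ ((t : ℝ) / 2) = 1 := by
      rw [hτ, ← Real.rpow_add ht0, neg_add_cancel, Real.rpow_zero]
    rw [norm_mul, hEn, ← mul_assoc τ, this, one_mul]
  have b3 : ‖∫ x in (Set.Ioc (-y) y)ᶜ, K x * E x‖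
      ≤ (∫ x in (Set.Ioc (-y) y)ᶜ, ‖K x‖) * Real.exp s := by
    refine (norm_integral_le_integral_norm _).trans (le_of_eq ?_)
    rw [← integral_mul_const]
    simp only [norm_mul, hEn]
  have a1 := h₁ t y ht hy hty
  have a2 := h₂ t y ht hy
  have a3 := h₃ t y ht hy hy2 hty
  set P : ℝ := t * Real.exp (-(2 * π / (t * y))) with hP
  set R : ℝ := Real.exp (-((t : ℝ) / 6)) with hR
  have hP0 : 0 ≤ P := by positivity
  have hR0 : 0 ≤ R := by positivity
  set w : ℝ := y ^ (1 - s) * (t : ℝ) ^ (-(1 / 2) : ℝ) with hw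
  have hw0 : 0 ≤ w := by positivity
  have hes := Real.exp_pos s
  have hnorm : |(tCoreCount t N : ℝ) - tCoreMainTerm t N|
      = ‖(tCoreCount t N : ℂ) - tCoreMainTerm t N‖ := by
    rw [← Real.norm_eq_abs, ← Complex.norm_real]
    push_cast
    rfl
  rw [hnorm, hsplit]
  calc _ ≤ ‖∫ x in (-y)..y, (Q x - τ * K x) * E x‖ + ‖∫ x in y..1 - y, Q x * E x‖
        + τ * ‖∫ x in (Set.Ioc (-y) y)ᶜ, K x * E x‖ := by
        refine (norm_sub_le _ _).trans ?_
        rw [norm_mul, Complex.norm_real, Real.norm_of_nonneg hτ0.le]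
        exact add_le_add_left (norm_add_le _ _) _
    _ ≤ (C₁ * (τ * (w * (P + R)))) * Real.exp s
        + τ * (C₃ * (y ^ (1 - s) * ((t : ℝ) ^ (-(1 / 2) : ℝ) * R))) * Real.exp s
        + τ * ((C₂ * (y ^ (1 - s) * ((t : ℝ) ^ (-(1 / 2) : ℝ) * R))) * Real.exp s) := by
        refine add_le_add (add_le_add (b1.trans ?_) (b2.trans ?_)) ?_
        · gcongr
        · gcongr
        · exact mul_le_mul_of_nonneg_left (b3.trans (by gcongr)) hτ0.le
    _ = (τ * (w * Real.exp s)) * (C₁ * (P + R) + (C₂ + C₃) * R) := by rw [hw]; ring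
    _ ≤ (τ * (w * Real.exp s)) * (C₁ * (P + R) + (C₂ + C₃) * (P + R)) := by
        gcongr
        linarith
    _ ≤ (C₄ * tCoreMainTerm t N) * (C₁ * (P + R) + (C₂ + C₃) * (P + R)) :=
        mul_le_mul_of_nonneg_right hMT (by positivity)
    _ = _ := by ring

theorem mainTheorem5 :
    ∃ C : ℝ, 0 < C ∧ ∀ ε : ℝ, 0 < ε → ∀ t N : ℕ, 6 ≤ t →
      (t : ℝ) * ((t : ℝ) - 1) / (4 * Real.pi * shiftedSize t N)
          ≤ 2 * Real.pi / ((2 + ε) * Real.log t) →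
      ∃ δ : ℝ,
        |δ| ≤ C * ((t : ℝ) ^ (-(1 / 2) : ℝ) * (1 + ε) ^ (-((t : ℝ) / 4))
          + Real.exp (-((t : ℝ) / 6))
          + (t : ℝ) * Real.exp (-(2 * Real.pi / ((t : ℝ) * saddleY t N)))) ∧
        (tCoreCount t N : ℝ) = tCoreMainTerm t N * (1 + δ) := by
  obtain ⟨C, hC, h⟩ := exists_abs_tCoreCount_sub_le
  refine ⟨C, hC, fun ε hε t N ht hcond => ?_⟩
  have hpi := Real.pi_pos
  have ht6 : (6 : ℝ) ≤ t := by exact_mod_cast ht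
  have hM := shiftedSize_pos (t := t) (by omega) N
  have hlog : 0 < Real.log t := Real.log_pos (by linarith)
  have hy : 0 < saddleY t N := by
    rw [saddleY]
    have : 0 < (t : ℝ) - 1 := by linarith
    positivity
  -- the hypothesis reads `(2 + ε) * (t * y * log t) ≤ 2 * π`
  have hty : t * saddleY t N * Real.log t ≤ π := by
    rw [mul_div_assoc, ← saddleY, le_div_iff₀ (by positivity)] at hcond
    have : 0 ≤ t * saddleY t N * Real.log t * ε := by positivity
    linarith
  have hMT : 0 < tCoreMainTerm t N := by
    have : 0 < Real.Gamma (((t : ℝ) - 1) / 2) := Real.Gamma_pos_of_pos (by linarith)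
    have : (0 : ℝ) < t := by linarith
    rw [tCoreMainTerm]
    positivity
  refine ⟨(tCoreCount t N - tCoreMainTerm t N) / tCoreMainTerm t N, ?_, by field_simp; ring⟩
  rw [abs_div, abs_of_pos hMT, div_le_iff₀ hMT]
  refine (h t N ht hty).trans ?_
  have h0 : 0 ≤ (t : ℝ) ^ (-(1 / 2) : ℝ) * (1 + ε) ^ (-((t : ℝ) / 4)) := by positivity
  calc C * tCoreMainTerm t N * (t * Real.exp (-(2 * π / (t * saddleY t N)))
        + Real.exp (-((t : ℝ) / 6)))
      ≤ C * tCoreMainTerm t N * ((t : ℝ) ^ (-(1 / 2) : ℝ) * (1 + ε) ^ (-((t : ℝ) / 4))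
        + Real.exp (-((t : ℝ) / 6)) + t * Real.exp (-(2 * π / (t * saddleY t N)))) := by
        refine mul_le_mul_of_nonneg_left ?_ (by positivity)
        linarith
    _ = _ := by ring

end CircleMethod
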